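/- Fix $\beta>0$. Let $\mathcal S$ be the set of probability measures $\mu=(\mu_i)_{i\ge 0}$ on $\mathbb N_0=\{0,1,2,\dots\}$ with finite mean $\overline\mu:=\sum_{i\ge 1} i\mu_i<\infty$, with the topology of the metric $d(\mu,\nu)=\sum_{i\ge 1} i\,|\mu_i-\nu_i|$. For $n\ge\beta$, $n \geq 1$, let $\mathbb P_n$ be the Erdős–Rényi distribution on simple graphs with vertex set $\{1,\dots,n\}$ in which each of the $\binom n2$ possible edges is present independently with probability $\beta/n$, and let $\mu^{(n)}=\frac1n\sum_{j=1}^n\delta_{d_j}\in\mathcal S$ be the empirical distribution of the degrees $d_1,\dots,d_n$ of the random graph. Define, for $\mu\in\mathcal S$, $$I(\mu)=\sum_{i=0}^\infty \mu_i\log(i!\,\mu_i)-\frac{\overline\mu}{2}\log(\overline\mu\beta)+\frac{\overline\mu+\beta}{2}\in(-\infty,\infty],$$ with the convention $0\log 0=0$. Then, with $\log 0=-\infty$ and $\inf\emptyset=\infty$, for every subset $A\subseteq\mathcal S$ with interior $A^\circ$, $$\limsup_{n\to\infty}\frac1n\log\mathbb P_n(\mu^{(n)}\in A)\le-\inf_{\mu\in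 A}I(\mu),$$ $$\liminf_{n\to\infty}\frac1n\log\mathbb P_n(\mu^{(n)}\in A)\ge-\inf_{\mu\in A^\circ}I(\mu).$$ Moreover $I$ is a good rate function on $\mathcal S$, that is, $I\ge 0$, $I$ is lower semicontinuous and $\{\mu\in\mathcal S: I(\mu)\le\alpha\}$ is compact for every $\alpha\in\mathbb R$. In particular, $\mu^{(n)}$ satisfies the large deviation principle in $\mathcal S$ with speed $n$ and good rate function $I$ (the upper bound for closed sets and the lower bound for open sets). -/

import Mathlib

open MeasureTheory Filter Topology
open scoped ENNReal

noncomputable section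

/-- The set `𝒮` of probability measures on `ℕ₀ = {0, 1, 2, …}` with finite mean. -/
def FiniteMeanDist : Type :=
  {p : PMF ℕ // Summable fun i : ℕ => (i : ℝ) * (p i).toReal}

namespace FiniteMeanDist

/-- The mass `μ_i` as a real number. -/
def mass (μ : FiniteMeanDist) (i : ℕ) : ℝ := (μ.1 i).toReal

/-- The mean `∑ i μ_i`. -/
def mean (μ : FiniteMeanDist) : ℝ := ∑' i : ℕ, (i : ℝ) * μ.mass i

theorem summable_mean (μ : FiniteMeanDist) : Summable fun i : ℕ => (i : ℝ) * μ.mass i := μ.2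

theorem mass_nonneg (μ : FiniteMeanDist) (i : ℕ) : 0 ≤ μ.mass i := ENNReal.toReal_nonneg

theorem hasSum_mass (μ : FiniteMeanDist) : HasSum μ.mass 1 := by
  have h := ENNReal.hasSum_toReal (f := fun i => μ.1 i) (by rw [μ.1.tsum_coe]; simp)
  rw [← ENNReal.tsum_toReal_eq (fun i => μ.1.apply_ne_top i), μ.1.tsum_coe] at h
  exact h

theorem summable_dist (μ ν : FiniteMeanDist) :
    Summable fun i : ℕ => (i : ℝ) * |μ.mass i - ν.mass i| := by
  refine Summable.of_nonneg_of_le (fun i => by positivity) (fun i => ?_)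
    (μ.summable_mean.add ν.summable_mean)
  rw [← mul_add]
  refine mul_le_mul_of_nonneg_left ?_ (Nat.cast_nonneg i)
  have := μ.mass_nonneg i
  have := ν.mass_nonneg i
  exact abs_le.2 ⟨by linarith, by linarith⟩

theorem ext_mass {μ ν : FiniteMeanDist} (h : ∀ i, i ≠ 0 → μ.mass i = ν.mass i) : μ = ν := by
  have h0 : μ.mass 0 = ν.mass 0 := by
    have h1 := μ.hasSum_mass.sub ν.hasSum_mass
    have h2 := hasSum_single (f := fun i => μ.mass i - ν.mass i) 0
      (fun i hi => by simp [h i hi])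
    have := h1.unique h2
    linarith
  refine Subtype.ext (PMF.ext fun i => ?_)
  have hi : μ.mass i = ν.mass i := by
    by_cases hi : i = 0
    · rw [hi, h0]
    · exact h i hi
  exact (ENNReal.toReal_eq_toReal_iff' (μ.1.apply_ne_top i) (ν.1.apply_ne_top i)).1 hi

/-- The metric `d(μ, ν) = ∑ i |μ_i - ν_i|`; the topology of `𝒮` is the one it induces. -/
instance : MetricSpace FiniteMeanDist where
  dist μ ν := ∑' i : ℕ, (i : ℝ) * |μ.mass i - ν.mass i|
  dist_self μ := by simp
  dist_comm μ ν := by simp only [abs_sub_comm]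
  dist_triangle μ ν ρ := by
    rw [← (summable_dist μ ν).tsum_add (summable_dist ν ρ)]
    refine (summable_dist μ ρ).tsum_le_tsum (fun i => ?_)
      ((summable_dist μ ν).add (summable_dist ν ρ))
    rw [← mul_add]
    exact mul_le_mul_of_nonneg_left (abs_sub_le _ _ _) (Nat.cast_nonneg i)
  eq_of_dist_eq_zero {μ ν} h := by
    have h' := (hasSum_zero_iff_of_nonneg (fun i => by positivity)).1
      (h ▸ (summable_dist μ ν).hasSum)
    refine ext_mass fun i hi => ?_
    have := congrFun h' i
    simp only [Pi.zero_apply, mul_eq_zero, Nat.cast_eq_zero, hi, abs_eq_zero, false_or] at this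
    linarith

end FiniteMeanDist

/-- The sum of a real series as an extended real number: the sum of the positive parts minus the
sum of the negative parts. -/
def extendedSum (a : ℕ → ℝ) : EReal :=
  ((∑' i, ENNReal.ofReal (a i) : ℝ≥0∞) : EReal) - ((∑' i, ENNReal.ofReal (-a i) : ℝ≥0∞) : EReal)

/-- The function `I(μ) = ∑ μ_i log(i! μ_i) - (μ̄ / 2) log(μ̄ β) + (μ̄ + β) / 2`. The conventions
`0 log 0 = 0` are those of `Real.log`. The negative part of the series is summable for `μ` of
finite mean, so that the series has a well-defined sum in `(-∞, ∞]`. -/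
def degreeRate (β : ℝ) (μ : FiniteMeanDist) : EReal :=
  extendedSum (fun i => μ.mass i * Real.log ((i.factorial : ℝ) * μ.mass i)) +
    ((-(μ.mean / 2) * Real.log (μ.mean * β) + (μ.mean + β) / 2 : ℝ) : EReal)

open Classical in
/-- The empirical distribution `(1/n) ∑ δ_{d_j}` of the degrees of a graph on `n ≥ 1` vertices:
the law of the degree of a uniformly chosen vertex. -/
def empiricalDegree {V : Type*} [Fintype V] [Nonempty V] (G : SimpleGraph V) : FiniteMeanDist :=
  ⟨(PMF.uniformOfFintype V).map fun v => G.degree v, by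
    refine summable_of_ne_finset_zero (s := Finset.univ.image fun v => G.degree v) fun i hi => ?_
    have : ((PMF.uniformOfFintype V).map fun v => G.degree v) i = 0 := by
      rw [PMF.apply_eq_zero_iff, PMF.support_map]
      rintro ⟨v, -, hv⟩
      exact hi (Finset.mem_image.2 ⟨v, Finset.mem_univ v, hv⟩)
    rw [this, ENNReal.toReal_zero, mul_zero]⟩

/-- The Erdős–Rényi distribution with edge probability `β / n` on the graphs with vertex set
`{0, …, n - 1}`. For the finitely many `n < β` the edge probability is cut off at `1`. -/
def erdosRenyi (β : ℝ) (n : ℕ) : Measure (SimpleGraph (Fin n)) :=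
  SimpleGraph.binomialRandom (Fin n) (Set.projIcc 0 1 zero_le_one (β / n))

/-- A rate function: lower semicontinuous with values in `[0, ∞]`. It is good if moreover its
level sets are compact. -/
structure IsGoodRateFunction {X : Type*} [TopologicalSpace X] (I : X → EReal) : Prop where
  nonneg : ∀ x, 0 ≤ I x
  lowerSemicontinuous : LowerSemicontinuous I
  isCompact_level : ∀ α : ℝ, IsCompact {x | I x ≤ (α : EReal)}

/-- The random elements `Y i`, defined on the spaces `(Ω i, P i)`, satisfy along `l` the large
deviation principle with speed `a` and rate function `I`. -/
structure SatisfiesLDP {ι X : Type*} [TopologicalSpace X] {Ω : ι → Type*}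
    [∀ i, MeasurableSpace (Ω i)] (P : ∀ i, Measure (Ω i)) (Y : ∀ i, Ω i → X) (l : Filter ι)
    (a : ι → ℝ) (I : X → EReal) : Prop where
  nonneg : ∀ x, 0 ≤ I x
  lowerSemicontinuous : LowerSemicontinuous I
  upper_bound : ∀ F : Set X, IsClosed F →
    limsup (fun i => ENNReal.log (P i {ω | Y i ω ∈ F}) / (a i : EReal)) l ≤ -(⨅ x ∈ F, I x)
  lower_bound : ∀ O : Set X, IsOpen O →
    -(⨅ x ∈ O, I x) ≤ liminf (fun i => ENNReal.log (P i {ω | Y i ω ∈ O}) / (a i : EReal)) l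

end

/-! Given its number `m` of edges, the random graph is uniform, so everything rests on counting
graphs by degree histogram. About `2 ^ m * m! / ∏ d_v!` graphs have degree sequence `d`. Summed over
the rearrangements of `d`, this gives the entropy relative to the weights `1 / i!`; the factor `2 ^
m * m!` and the edge probabilities depend only on the mean `2 * m / n` and give the remaining terms
of `I`.

The count comes from adding edges one at a time. An edge set has as weight the number of ways to
attach its edges to half-edges, a product of falling factorials. By `succ_mul_edgeWeightSum_succ`,
passing from `k` to `k + 1` edges multiplies the total weight by a sum over pairs of free
half-edges. That sum is at most `2 * (m - k) ^ 2` when there are `2 * m` half-edges, and at least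
this when bounded degrees come with `M + M ^ 2` spare half-edges, which pay for loops and repeated
edges.

Upper bound: the product measure of the histogram itself gives total mass at most one to all degree
sequences, which yields the entropy bound `card_empiricalDegree_eq_le`. The rate exceeds every
linear function of the mean up to a constant (`mul_mean_sub_le_degreeRate`), so a fraction `ε` of it
can be spent on a factor decaying in the total degree. With this factor the sum over all histograms
stays bounded in `n`, by the generating function of partitions (`sum_exp_neg_mul_mean_le`). No
closedness or compactness is needed, so the bound holds for every `A`.

Lower bound: for finitely supported `ν`, round `n ν` to a histogram and count graphs whose degrees
lie below a rearrangement of it, with bounded total deficit. Double counting graphs against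
permutations (`factorial_mul_le_ncard_degree_le_perm`) loses only a power of `n`, and the deficit
moves the empirical law by `O(1/n)`. A general `μ` of finite rate is approximated by truncations,
along which the rate converges (`tendsto_entropySum_trunc`).

Goodness: `I` is a sum of nonnegative continuous terms plus a continuous function of the mean, hence
lower semicontinuous. Young's inequality makes the tails of the mean uniformly small on level sets
(`exists_uniform_tail`), which gives compactness in the weighted `ℓ¹` metric. -/

/-! ### Young's inequality and extended sums -/

/-- Young's inequality for the entropy function. -/
theorem mul_le_mul_log_sub_add_exp_div {x c : ℝ} (hx : 0 ≤ x) (hc : 0 < c) (y : ℝ) :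
    x * y ≤ x * Real.log (c * x) - x + Real.exp y / c := by
  rcases hx.eq_or_lt with rfl | hx
  · have := Real.exp_pos y
    simp only [zero_mul, sub_zero, zero_add]
    positivity
  · have h := Real.add_one_le_exp (y - Real.log (c * x))
    rw [Real.exp_sub, Real.exp_log (by positivity)] at h
    have h2 := mul_le_mul_of_nonneg_left h hx.le
    have h3 : x * (Real.exp y / (c * x)) = Real.exp y / c := by field_simp
    rw [h3] at h2
    linarith

theorem Real.hasSum_pow_div_factorial (x : ℝ) :
    HasSum (fun i : ℕ => x ^ i / (i.factorial : ℝ)) (Real.exp x) := by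
  rw [Real.exp_eq_exp_ℝ]
  exact NormedSpace.expSeries_div_hasSum_exp x

theorem extendedSum_of_summable {a : ℕ → ℝ} (ha : Summable a) :
    extendedSum a = ((∑' i, a i : ℝ) : EReal) := by
  have hp : Summable fun i => max (a i) 0 := by
    refine Summable.of_nonneg_of_le (fun i => le_max_right _ _) (fun i => ?_) ha.abs
    exact max_le (le_abs_self _) (abs_nonneg _)
  have hn : Summable fun i => max (-a i) 0 := by
    refine Summable.of_nonneg_of_le (fun i => le_max_right _ _) (fun i => ?_) ha.abs
    exact max_le (neg_le_abs _) (abs_nonneg _)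
  have e1 : ∑' i, ENNReal.ofReal (a i) = ENNReal.ofReal (∑' i, max (a i) 0) := by
    rw [ENNReal.ofReal_tsum_of_nonneg (fun i => le_max_right _ _) hp]
    simp
  have e2 : ∑' i, ENNReal.ofReal (-a i) = ENNReal.ofReal (∑' i, max (-a i) 0) := by
    rw [ENNReal.ofReal_tsum_of_nonneg (fun i => le_max_right _ _) hn]
    simp
  rw [extendedSum, e1, e2, EReal.coe_ennreal_ofReal, EReal.coe_ennreal_ofReal,
    max_eq_left (tsum_nonneg fun i => le_max_right _ _),
    max_eq_left (tsum_nonneg fun i => le_max_right _ _), ← EReal.coe_sub, ← hp.tsum_sub hn]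
  congr 2
  ext i
  rcases le_total (a i) 0 with h | h
  · rw [max_eq_right h, max_eq_left (by linarith)]; ring
  · rw [max_eq_left h, max_eq_right (by linarith)]; ring

/-- If `a + b` is nonnegative and `b` is summable, the extended sum of `a` is the `[0, ∞]`-valued
sum of `a + b`, shifted by the sum of `b`. -/
theorem extendedSum_eq_tsum_ofReal_add {a b : ℕ → ℝ} (hab : ∀ i, 0 ≤ a i + b i)
    (hb : Summable b) :
    extendedSum a =
      ((∑' i, ENNReal.ofReal (a i + b i) : ℝ≥0∞) : EReal) + ((-∑' i, b i : ℝ) : EReal) := by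
  by_cases h : ∑' i, ENNReal.ofReal (a i + b i) = ⊤
  · have hbt : ∑' i, ENNReal.ofReal |b i| ≠ ⊤ := hb.abs.tsum_ofReal_ne_top
    have hneg : ∑' i, ENNReal.ofReal (-a i) ≠ ⊤ := by
      refine ne_top_of_le_ne_top hbt (ENNReal.tsum_le_tsum fun i => ENNReal.ofReal_le_ofReal ?_)
      have := hab i
      have := le_abs_self (b i)
      linarith
    have hpos : ∑' i, ENNReal.ofReal (a i) = ⊤ := by
      by_contra hne
      refine absurd h (ne_top_of_le_ne_top (ENNReal.add_ne_top.2 ⟨hne, hbt⟩) ?_)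
      rw [← ENNReal.tsum_add]
      refine ENNReal.tsum_le_tsum fun i => ?_
      refine ENNReal.ofReal_add_le.trans ?_
      gcongr
      exact le_abs_self _
    rw [extendedSum, h, hpos, EReal.coe_ennreal_top, EReal.top_add_coe]
    lift (∑' i, ENNReal.ofReal (-a i)) to NNReal using hneg with r
    rfl
  · have hs : Summable fun i => a i + b i := by
      have := ENNReal.summable_toReal h
      refine this.congr fun i => ?_
      rw [ENNReal.toReal_ofReal (hab i)]
    have ha : Summable a := by
      simpa using hs.sub hb
    rw [extendedSum_of_summable ha, ← ENNReal.ofReal_tsum_of_nonneg hab hs,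
      EReal.coe_ennreal_ofReal, max_eq_left (tsum_nonneg hab), ← EReal.coe_add,
      ha.tsum_add hb]
    congr 1
    ring

/-! ### Continuity of masses, mean and entropy terms -/

namespace FiniteMeanDist

theorem mass_le_one (μ : FiniteMeanDist) (i : ℕ) : μ.mass i ≤ 1 :=
  le_hasSum μ.hasSum_mass i fun j _ => μ.mass_nonneg j

theorem mean_nonneg (μ : FiniteMeanDist) : 0 ≤ μ.mean :=
  tsum_nonneg fun i => mul_nonneg (Nat.cast_nonneg i) (μ.mass_nonneg i)

theorem hasSum_mean (μ : FiniteMeanDist) : HasSum (fun i : ℕ => (i : ℝ) * μ.mass i) μ.mean :=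
  μ.summable_mean.hasSum

theorem dist_def (μ ν : FiniteMeanDist) :
    dist μ ν = ∑' i : ℕ, (i : ℝ) * |μ.mass i - ν.mass i| := rfl

/-- The metric gives index `0` no weight; since total masses agree, the difference there is minus
the sum of the other differences. -/
theorem abs_mass_sub_le_dist (μ ν : FiniteMeanDist) (i : ℕ) :
    |μ.mass i - ν.mass i| ≤ dist μ ν := by
  have key : ∀ j, j ≠ 0 → |μ.mass j - ν.mass j| ≤ (j : ℝ) * |μ.mass j - ν.mass j| := by
    intro j hj
    have : (1 : ℝ) ≤ j := by exact_mod_cast Nat.one_le_iff_ne_zero.2 hj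
    nlinarith [abs_nonneg (μ.mass j - ν.mass j)]
  by_cases hi : i = 0
  · subst hi
    have h := μ.hasSum_mass.sub ν.hasSum_mass
    rw [sub_self] at h
    have h1 := (h.summable.hasSum_iff.1 h)
    rw [h.summable.tsum_eq_zero_add] at h1
    have h2 : μ.mass 0 - ν.mass 0 = -∑' j, (μ.mass (j + 1) - ν.mass (j + 1)) := by linarith
    have hsd := (summable_nat_add_iff 1).2 (summable_dist μ ν)
    rw [h2, abs_neg, dist_def, (summable_dist μ ν).tsum_eq_zero_add]
    simp only [Nat.cast_zero, zero_mul, zero_add]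
    rw [← Real.norm_eq_abs]
    refine tsum_of_norm_bounded hsd.hasSum fun j => ?_
    exact key (j + 1) (by simp)
  · refine (key i hi).trans ?_
    exact (summable_dist μ ν).le_tsum i fun j _ => by positivity

theorem continuous_mass (i : ℕ) : Continuous fun μ : FiniteMeanDist => μ.mass i :=
  LipschitzWith.continuous (K := 1) <| LipschitzWith.of_dist_le_mul fun μ ν => by
    simpa [Real.dist_eq] using abs_mass_sub_le_dist μ ν i

theorem continuous_mean : Continuous mean :=
  LipschitzWith.continuous (K := 1) <| LipschitzWith.of_dist_le_mul fun μ ν => by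
    rw [Real.dist_eq, mean, mean, ← μ.summable_mean.tsum_sub ν.summable_mean, NNReal.coe_one,
      one_mul, dist_def, ← Real.norm_eq_abs]
    refine tsum_of_norm_bounded (summable_dist μ ν).hasSum fun i => ?_
    rw [← mul_sub, norm_mul]
    simp

/-- The `i`-th term of the relative entropy of `μ` with respect to the measure `1 / i!`. -/
noncomputable def entropyTerm (μ : FiniteMeanDist) (i : ℕ) : ℝ :=
  μ.mass i * Real.log ((i.factorial : ℝ) * μ.mass i) + (1 / (i.factorial : ℝ) - μ.mass i)

/-- Young's inequality with `c = i!`. Taking `y = 0` gives nonnegativity, and `y = i * s` controls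
the tails of the mean. -/
theorem mul_le_entropyTerm (μ : FiniteMeanDist) (i : ℕ) (y : ℝ) :
    μ.mass i * y ≤ μ.entropyTerm i - 1 / (i.factorial : ℝ) + Real.exp y / (i.factorial : ℝ) := by
  have h := mul_le_mul_log_sub_add_exp_div (μ.mass_nonneg i)
    (c := (i.factorial : ℝ)) (by positivity) y
  rw [entropyTerm]
  linarith

theorem entropyTerm_nonneg (μ : FiniteMeanDist) (i : ℕ) : 0 ≤ μ.entropyTerm i := by
  have h := μ.mul_le_entropyTerm i 0
  simp only [mul_zero, Real.exp_zero] at h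
  linarith

theorem continuous_entropyTerm (i : ℕ) : Continuous fun μ : FiniteMeanDist => μ.entropyTerm i := by
  have h : (fun μ : FiniteMeanDist => μ.entropyTerm i) = fun μ : FiniteMeanDist =>
      (((i.factorial : ℝ) * μ.mass i) * Real.log ((i.factorial : ℝ) * μ.mass i)) /
        (i.factorial : ℝ) + (1 / (i.factorial : ℝ) - μ.mass i) := by
    ext μ
    have : (i.factorial : ℝ) ≠ 0 := by positivity
    rw [entropyTerm]
    field_simp
  rw [h]
  have h1 := (continuous_const (y := (i.factorial : ℝ))).mul (continuous_mass i)
  exact ((Real.continuous_mul_log.comp h1).div_const _).add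
    (continuous_const.sub (continuous_mass i))

theorem hasSum_inv_factorial_sub_mass (μ : FiniteMeanDist) :
    HasSum (fun i : ℕ => 1 / (i.factorial : ℝ) - μ.mass i) (Real.exp 1 - 1) := by
  have h := Real.hasSum_pow_div_factorial 1
  simp only [one_pow] at h
  exact h.sub μ.hasSum_mass

end FiniteMeanDist

/-! ### Lower semicontinuity and growth of the rate function -/

/-- The part of the rate function which depends on the mean only. -/
noncomputable def meanRate (β m : ℝ) : ℝ := -(m / 2) * Real.log (m * β) + (m + β) / 2

theorem continuous_meanRate {β : ℝ} (hβ : 0 < β) : Continuous (meanRate β) := by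
  have h : meanRate β = fun m => -((m * β) * Real.log (m * β)) / (2 * β) + (m + β) / 2 := by
    ext m
    rw [meanRate]
    field_simp
  rw [h]
  have h1 : Continuous fun m : ℝ => (m * β) * Real.log (m * β) :=
    Real.continuous_mul_log.comp (continuous_id.mul continuous_const)
  fun_prop

/-- Adding `1 / i! - μ_i` makes every term nonnegative and changes the sum by `e - 1`, whatever `μ`
is. -/
theorem degreeRate_eq (β : ℝ) (μ : FiniteMeanDist) :
    degreeRate β μ = ((∑' i, ENNReal.ofReal (μ.entropyTerm i) : ℝ≥0∞) : EReal) +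
      ((1 - Real.exp 1 + meanRate β μ.mean : ℝ) : EReal) := by
  have h := μ.hasSum_inv_factorial_sub_mass
  rw [degreeRate, extendedSum_eq_tsum_ofReal_add (μ.entropyTerm_nonneg) h.summable, h.tsum_eq,
    add_assoc, ← EReal.coe_add]
  congr 2
  rw [meanRate]
  ring

theorem lowerSemicontinuous_degreeRate {β : ℝ} (hβ : 0 < β) :
    LowerSemicontinuous (degreeRate β) := by
  have h1 : LowerSemicontinuous fun μ : FiniteMeanDist =>
      ((∑' i, ENNReal.ofReal (μ.entropyTerm i) : ℝ≥0∞) : EReal) := by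
    refine continuous_coe_ennreal_ereal.comp_lowerSemicontinuous
      (lowerSemicontinuous_tsum fun i => ?_) fun a b h => EReal.coe_ennreal_le_coe_ennreal_iff.2 h
    exact (ENNReal.continuous_ofReal.comp
      (FiniteMeanDist.continuous_entropyTerm i)).lowerSemicontinuous
  have h2 : Continuous fun μ : FiniteMeanDist =>
      ((1 - Real.exp 1 + meanRate β μ.mean : ℝ) : EReal) :=
    continuous_coe_real_ereal.comp
      (continuous_const.add ((continuous_meanRate hβ).comp FiniteMeanDist.continuous_mean))
  rw [show degreeRate β = _ from funext (degreeRate_eq β)]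
  refine h1.add' h2.lowerSemicontinuous fun μ => ?_
  exact EReal.continuousAt_add (Or.inr (EReal.coe_ne_bot _)) (Or.inr (EReal.coe_ne_top _))

namespace FiniteMeanDist

/-- The real sum `∑ μ_i log (i! μ_i)`. -/
noncomputable def entropySum (μ : FiniteMeanDist) : ℝ :=
  ∑' i : ℕ, μ.mass i * Real.log ((i.factorial : ℝ) * μ.mass i)

end FiniteMeanDist

theorem degreeRate_of_summable (β : ℝ) {μ : FiniteMeanDist}
    (h : Summable fun i : ℕ => μ.mass i * Real.log ((i.factorial : ℝ) * μ.mass i)) :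
    degreeRate β μ = ((μ.entropySum + meanRate β μ.mean : ℝ) : EReal) := by
  rw [degreeRate, extendedSum_of_summable h, ← EReal.coe_add]
  rfl

theorem summable_of_degreeRate_ne_top {β : ℝ} {μ : FiniteMeanDist} (h : degreeRate β μ ≠ ⊤) :
    Summable fun i : ℕ => μ.mass i * Real.log ((i.factorial : ℝ) * μ.mass i) := by
  have h1 : ∑' i, ENNReal.ofReal (μ.entropyTerm i) ≠ ⊤ := by
    rintro h2
    rw [degreeRate_eq, h2, EReal.coe_ennreal_top, EReal.top_add_coe] at h
    exact h rfl
  have h2 : Summable μ.entropyTerm := by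
    refine (ENNReal.summable_toReal h1).congr fun i => ?_
    rw [ENNReal.toReal_ofReal (μ.entropyTerm_nonneg i)]
  refine (h2.sub μ.hasSum_inv_factorial_sub_mass.summable).congr fun i => ?_
  rw [FiniteMeanDist.entropyTerm]
  ring

/-- Gibbs' inequality against the Poisson law of parameter `r`, at the optimal value `r = μ.mean`.
-/
theorem mean_mul_log_sub_le_entropySum {μ : FiniteMeanDist}
    (h : Summable fun i : ℕ => μ.mass i * Real.log ((i.factorial : ℝ) * μ.mass i)) :
    μ.mean * Real.log μ.mean - μ.mean ≤ μ.entropySum := by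
  have key : ∀ r : ℝ, 0 < r → μ.mean * Real.log r - r ≤ μ.entropySum := by
    intro r hr
    have hl : HasSum (fun i : ℕ => μ.mass i * (i * Real.log r - r)) (μ.mean * Real.log r - r) := by
      have := (μ.hasSum_mean.mul_right (Real.log r)).sub (μ.hasSum_mass.mul_right r)
      rw [one_mul] at this
      have he : (fun i : ℕ => μ.mass i * (i * Real.log r - r)) =
          fun i : ℕ => (i : ℝ) * μ.mass i * Real.log r - μ.mass i * r := by
        funext i
        ring
      rwa [he]
    have hu : HasSum (fun i : ℕ => μ.mass i * Real.log ((i.factorial : ℝ) * μ.mass i) - μ.mass i +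
        r ^ i / (i.factorial : ℝ) * Real.exp (-r)) (μ.entropySum) := by
      have := (h.hasSum.sub μ.hasSum_mass).add
        ((Real.hasSum_pow_div_factorial r).mul_right (Real.exp (-r)))
      rw [← Real.exp_add, add_neg_cancel, Real.exp_zero, sub_add_cancel] at this
      exact this
    refine hasSum_le (fun i => ?_) hl hu
    have h1 := mul_le_mul_log_sub_add_exp_div (μ.mass_nonneg i)
      (c := (i.factorial : ℝ)) (by positivity) (i * Real.log r - r)
    have h2 : Real.exp (i * Real.log r - r) = r ^ i * Real.exp (-r) := by
      rw [sub_eq_add_neg, Real.exp_add, Real.exp_nat_mul, Real.exp_log hr]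
    rw [h2, mul_div_right_comm] at h1
    exact h1
  rcases μ.mean_nonneg.eq_or_lt with h0 | h0
  -- At mean zero the optimal parameter is excluded, so `r` tends to `0` instead.
  · rw [← h0]
    simp only [zero_mul, sub_zero]
    refine le_of_forall_pos_sub_le fun r hr => ?_
    have := key r hr
    rw [← h0] at this
    simpa using this
  · exact key _ h0

/-- After minimizing the entropy at fixed mean `x`, the rate is `(x log (x / β) - x + β) / 2`;
Young's inequality at slope `2 * t` bounds this below by a line. -/
theorem entropy_mean_le_of_summable {β : ℝ} (hβ : 0 < β) {μ : FiniteMeanDist}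
    (h : Summable fun i : ℕ => μ.mass i * Real.log ((i.factorial : ℝ) * μ.mass i)) (t : ℝ) :
    t * μ.mean - β * (Real.exp (2 * t) - 1) / 2 ≤ μ.entropySum + meanRate β μ.mean := by
  have h1 := mean_mul_log_sub_le_entropySum h
  have h2 := mul_le_mul_log_sub_add_exp_div μ.mean_nonneg (inv_pos.2 hβ) (2 * t)
  rw [meanRate]
  rw [div_inv_eq_mul] at h2
  rcases μ.mean_nonneg.eq_or_lt with h0 | h0
  · rw [← h0] at h1 h2 ⊢
    simp only [zero_mul, mul_zero, zero_div, neg_zero, sub_zero, zero_add, zero_sub] at h1 h2 ⊢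
    linarith
  · rw [Real.log_mul h0.ne' hβ.ne']
    rw [Real.log_mul (inv_pos.2 hβ).ne' h0.ne', Real.log_inv] at h2
    nlinarith

/-- The rate function grows faster than any linear function of the mean. -/
theorem mul_mean_sub_le_degreeRate {β : ℝ} (hβ : 0 < β) (μ : FiniteMeanDist) (t : ℝ) :
    ((t * μ.mean - β * (Real.exp (2 * t) - 1) / 2 : ℝ) : EReal) ≤ degreeRate β μ := by
  by_cases h : degreeRate β μ = ⊤
  · rw [h]; exact le_top
  · have hs := summable_of_degreeRate_ne_top h
    rw [degreeRate_of_summable β hs, EReal.coe_le_coe_iff]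
    exact entropy_mean_le_of_summable hβ hs t

theorem degreeRate_nonneg {β : ℝ} (hβ : 0 < β) (μ : FiniteMeanDist) : 0 ≤ degreeRate β μ := by
  simpa using mul_mean_sub_le_degreeRate hβ μ 0

/-! ### Compactness of the level sets -/

namespace FiniteMeanDist

/-- The element of `FiniteMeanDist` with given masses. -/
noncomputable def ofMass (x : ℕ → ℝ) (hx : ∀ i, 0 ≤ x i) (h1 : HasSum x 1)
    (hm : Summable fun i : ℕ => (i : ℝ) * x i) : FiniteMeanDist :=
  ⟨⟨fun i => ENNReal.ofReal (x i), by
    rw [← ENNReal.ofReal_one, ← h1.tsum_eq, ENNReal.ofReal_tsum_of_nonneg hx h1.summable]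
    exact ENNReal.summable.hasSum⟩, by
    refine hm.congr fun i => ?_
    change _ = (i : ℝ) * (ENNReal.ofReal (x i)).toReal
    rw [ENNReal.toReal_ofReal (hx i)]⟩

theorem mass_ofMass (x : ℕ → ℝ) (hx : ∀ i, 0 ≤ x i) (h1 : HasSum x 1)
    (hm : Summable fun i : ℕ => (i : ℝ) * x i) (i : ℕ) : (ofMass x hx h1 hm).mass i = x i :=
  ENNReal.toReal_ofReal (hx i)

end FiniteMeanDist

/-- Nonnegative series that converge termwise and have uniformly small tails converge in `ℓ¹`. -/
theorem summable_and_tendsto_tsum_abs_sub {f : ℕ → ℕ → ℝ} {g : ℕ → ℝ} (hf : ∀ k i, 0 ≤ f k i)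
    (hlim : ∀ i, Tendsto (fun k => f k i) atTop (𝓝 (g i)))
    (htail : ∀ ε > 0, ∃ N, ∀ k, ∀ F : Finset ℕ, (∀ i ∈ F, N ≤ i) → ∑ i ∈ F, f k i ≤ ε) :
    Summable g ∧ Tendsto (fun k => ∑' i, |f k i - g i|) atTop (𝓝 0) := by
  have hg : ∀ i, 0 ≤ g i := fun i => ge_of_tendsto' (hlim i) fun k => hf k i
  have hgtail : ∀ ε > 0, ∃ N, (∀ k, ∀ F : Finset ℕ, (∀ i ∈ F, N ≤ i) → ∑ i ∈ F, f k i ≤ ε) ∧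
      ∀ F : Finset ℕ, (∀ i ∈ F, N ≤ i) → ∑ i ∈ F, g i ≤ ε := by
    intro ε hε
    obtain ⟨N, hN⟩ := htail ε hε
    exact ⟨N, hN, fun F hF => le_of_tendsto' (tendsto_finsetSum F fun i _ => hlim i)
      fun k => hN k F hF⟩
  constructor
  · rw [summable_iff_vanishing_norm]
    intro ε hε
    obtain ⟨N, -, hN⟩ := hgtail (ε / 2) (by positivity)
    refine ⟨Finset.range N, fun F hF => ?_⟩
    rw [Real.norm_of_nonneg (Finset.sum_nonneg fun i _ => hg i)]
    have := hN F fun i hi => by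
      by_contra hlt
      exact Finset.disjoint_left.1 hF hi (Finset.mem_range.2 (not_le.1 hlt))
    linarith
  · rw [Metric.tendsto_atTop]
    intro ε hε
    obtain ⟨N, hN1, hN2⟩ := hgtail (ε / 4) (by positivity)
    have h0 : Tendsto (fun k => ∑ i ∈ Finset.range N, |f k i - g i|) atTop (𝓝 0) := by
      have := tendsto_finsetSum (Finset.range N) fun i _ =>
        ((hlim i).sub_const (g i)).abs
      simpa using this
    obtain ⟨k₀, hk₀⟩ := (Metric.tendsto_atTop.1 h0) (ε / 4) (by positivity)
    refine ⟨k₀, fun k hk => ?_⟩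
    have h1 := hk₀ k hk
    rw [Real.dist_eq, sub_zero] at h1 ⊢
    have h1' := (le_abs_self _).trans_lt h1
    have hle : ∑' i, |f k i - g i| ≤ 3 * (ε / 4) := by
      refine Real.tsum_le_of_sum_le (fun i => abs_nonneg _) (fun F => ?_)
      rw [← Finset.sum_filter_add_sum_filter_not F (fun i => i < N)]
      have ha : ∑ i ∈ F with i < N, |f k i - g i| ≤ ∑ i ∈ Finset.range N, |f k i - g i| := by
        refine Finset.sum_le_sum_of_subset_of_nonneg (fun i hi => ?_) fun i _ _ => abs_nonneg _
        exact Finset.mem_range.2 (Finset.mem_filter.1 hi).2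
      have hb : ∑ i ∈ F with ¬ i < N, |f k i - g i| ≤
          ∑ i ∈ F with ¬ i < N, f k i + ∑ i ∈ F with ¬ i < N, g i := by
        rw [← Finset.sum_add_distrib]
        refine Finset.sum_le_sum fun i _ => ?_
        have := hf k i
        have := hg i
        exact abs_le.2 ⟨by linarith, by linarith⟩
      have hmem : ∀ i ∈ F.filter (fun i => ¬ i < N), N ≤ i := fun i hi =>
        not_lt.1 (Finset.mem_filter.1 hi).2
      have := hN1 k _ hmem
      have := hN2 _ hmem
      linarith
    rw [abs_of_nonneg (tsum_nonneg fun i => abs_nonneg _)]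
    linarith

/-- Linear growth with slope `1` bounds the mean on a level set, so the continuous mean part is
bounded below there and the entropy terms must carry a bounded sum. -/
theorem exists_entropyTerm_bound {β : ℝ} (hβ : 0 < β) (α : ℝ) :
    ∃ C : ℝ, ∀ μ : FiniteMeanDist, degreeRate β μ ≤ (α : EReal) →
      ∀ F : Finset ℕ, ∑ i ∈ F, μ.entropyTerm i ≤ C := by
  set K : ℝ := α + β * (Real.exp (2 * 1) - 1) / 2 with hK
  obtain ⟨c, hc⟩ := (isCompact_Icc (a := (0 : ℝ)) (b := K)).bddBelow_image
    (continuous_meanRate hβ).continuousOn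
  refine ⟨α - 1 + Real.exp 1 - c, fun μ hμ F => ?_⟩
  have hm : μ.mean ≤ K := by
    have := (mul_mean_sub_le_degreeRate hβ μ 1).trans hμ
    rw [EReal.coe_le_coe_iff] at this
    linarith
  have hmc : c ≤ meanRate β μ.mean := hc ⟨μ.mean, ⟨μ.mean_nonneg, hm⟩, rfl⟩
  rw [degreeRate_eq] at hμ
  have h1 : ((∑ i ∈ F, μ.entropyTerm i : ℝ) : EReal) ≤
      ((∑' i, ENNReal.ofReal (μ.entropyTerm i) : ℝ≥0∞) : EReal) := by
    have := ENNReal.sum_le_tsum (f := fun i => ENNReal.ofReal (μ.entropyTerm i)) F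
    rw [← ENNReal.ofReal_sum_of_nonneg fun i _ => μ.entropyTerm_nonneg i] at this
    have h2 := EReal.coe_ennreal_le_coe_ennreal_iff.2 this
    rwa [EReal.coe_ennreal_ofReal,
      max_eq_left (Finset.sum_nonneg fun i _ => μ.entropyTerm_nonneg i)] at h2
  have h2 := (add_le_add_left h1 ((1 - Real.exp 1 + meanRate β μ.mean : ℝ) : EReal)).trans hμ
  rw [← EReal.coe_add, EReal.coe_le_coe_iff] at h2
  linarith

theorem exists_uniform_tail {β : ℝ} (hβ : 0 < β) (α : ℝ) {ε : ℝ} (hε : 0 < ε) :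
    ∃ N : ℕ, 0 < N ∧ ∀ μ : FiniteMeanDist, degreeRate β μ ≤ (α : EReal) → ∀ F : Finset ℕ,
      (∀ i ∈ F, N ≤ i) → ∑ i ∈ F, (i : ℝ) * μ.mass i ≤ ε := by
  obtain ⟨C, hC⟩ := exists_entropyTerm_bound hβ α
  -- The slope is chosen so that the entropy bound `C`, plus at most `1` from the exponential
  -- series, is at most `s * ε`.
  set s : ℝ := (|C| + 1) / ε with hs
  have hs0 : 0 < s := by positivity
  obtain ⟨T, hT⟩ := summable_iff_vanishing_norm.1
    (Real.hasSum_pow_div_factorial (Real.exp s)).summable 1 one_pos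
  refine ⟨T.sup id + 1, by positivity, fun μ hμ F hF => ?_⟩
  have hdisj : Disjoint F T := by
    rw [Finset.disjoint_left]
    intro i hi hiT
    have h1 := hF i hi
    have h2 : i ≤ T.sup id := Finset.le_sup (f := id) hiT
    omega
  have h1 := (le_abs_self _).trans_lt (hT F hdisj)
  have h2 : s * ∑ i ∈ F, (i : ℝ) * μ.mass i ≤
      ∑ i ∈ F, μ.entropyTerm i + ∑ i ∈ F, Real.exp s ^ i / (i.factorial : ℝ) := by
    rw [Finset.mul_sum, ← Finset.sum_add_distrib]
    refine Finset.sum_le_sum fun i _ => ?_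
    have h := μ.mul_le_entropyTerm i (i * s)
    rw [Real.exp_nat_mul] at h
    have : 0 < 1 / (i.factorial : ℝ) := by positivity
    linarith
  have h3 := hC μ hμ F
  have h4 : s * ∑ i ∈ F, (i : ℝ) * μ.mass i ≤ s * ε := by
    have : s * ε = |C| + 1 := by rw [hs]; field_simp
    have := le_abs_self C
    linarith
  exact le_of_mul_le_mul_left h4 hs0

theorem isCompact_degreeRate_le {β : ℝ} (hβ : 0 < β) (α : ℝ) :
    IsCompact {μ | degreeRate β μ ≤ (α : EReal)} := by
  rw [isCompact_iff_isSeqCompact]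
  intro u hu
  have hu' : ∀ k, degreeRate β (u k) ≤ (α : EReal) := hu
  -- Compactness of the cube gives a termwise limit; the uniform tails then prevent loss of mass or
  -- of mean.
  obtain ⟨x, -, φ, hφ, hx⟩ := (isCompact_univ_pi fun _ : ℕ =>
    isCompact_Icc (a := (0 : ℝ)) (b := 1)).tendsto_subseq (x := fun k i => (u k).mass i)
      fun k i _ => ⟨(u k).mass_nonneg i, (u k).mass_le_one i⟩
  rw [tendsto_pi_nhds] at hx
  have hx0 : ∀ i, 0 ≤ x i := fun i => ge_of_tendsto' (hx i) fun k => (u (φ k)).mass_nonneg i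
  obtain ⟨hm, hmlim⟩ := summable_and_tendsto_tsum_abs_sub
    (f := fun k i => (i : ℝ) * (u (φ k)).mass i) (g := fun i => (i : ℝ) * x i)
    (fun k i => mul_nonneg (Nat.cast_nonneg i) ((u (φ k)).mass_nonneg i))
    (fun i => (hx i).const_mul _) (fun ε hε => by
      obtain ⟨N, -, hN⟩ := exists_uniform_tail hβ α hε
      exact ⟨N, fun k => hN _ (hu' _)⟩)
  obtain ⟨hs, hslim⟩ := summable_and_tendsto_tsum_abs_sub
    (f := fun k i => (u (φ k)).mass i) (g := x) (fun k i => (u (φ k)).mass_nonneg i) hx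
    (fun ε hε => by
      obtain ⟨N, hN0, hN⟩ := exists_uniform_tail hβ α hε
      refine ⟨N, fun k F hF => (Finset.sum_le_sum fun i hi => ?_).trans (hN _ (hu' (φ k)) F hF)⟩
      have : (1 : ℝ) ≤ i := by exact_mod_cast hN0.trans_le (hF i hi)
      nlinarith [(u (φ k)).mass_nonneg i])
  have h1 : HasSum x 1 := by
    rw [hs.hasSum_iff]
    have hle : ∀ k, |1 - ∑' i, x i| ≤ ∑' i, |(u (φ k)).mass i - x i| := by
      intro k
      have hsub := (u (φ k)).hasSum_mass.sub hs.hasSum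
      rw [← hsub.tsum_eq, ← Real.norm_eq_abs]
      exact tsum_of_norm_bounded hsub.summable.abs.hasSum fun i => le_rfl
    have := ge_of_tendsto' hslim hle
    have := abs_nonpos_iff.1 this
    linarith
  have hlim : Tendsto (u ∘ φ) atTop (𝓝 (FiniteMeanDist.ofMass x hx0 h1 hm)) := by
    rw [tendsto_iff_dist_tendsto_zero]
    refine hmlim.congr fun k => ?_
    rw [Function.comp_apply, FiniteMeanDist.dist_def]
    refine tsum_congr fun i => ?_
    rw [FiniteMeanDist.mass_ofMass, ← mul_sub, abs_mul, Nat.abs_cast]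
  have hcl : IsClosed {μ | degreeRate β μ ≤ (α : EReal)} :=
    (lowerSemicontinuous_degreeRate hβ).isClosed_preimage (α : EReal)
  exact ⟨_, hcl.mem_of_tendsto hlim (Eventually.of_forall fun k => hu' _), φ, hφ, hlim⟩

theorem isGoodRateFunction_degreeRate {β : ℝ} (hβ : 0 < β) :
    IsGoodRateFunction (degreeRate β) where
  nonneg := degreeRate_nonneg hβ
  lowerSemicontinuous := lowerSemicontinuous_degreeRate hβ
  isCompact_level := isCompact_degreeRate_le hβ

/-! ### Attaching edges to half-edges one at a time -/

theorem Finset.succ_mul_sum_powersetCard_succ {α : Type*} [DecidableEq α] (U : Finset α) (k : ℕ)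
    (f : Finset α → ℕ) :
    (k + 1) * ∑ S ∈ U.powersetCard (k + 1), f S =
      ∑ T ∈ U.powersetCard k, ∑ e ∈ U \ T, f (insert e T) := by
  have h1 : (k + 1) * ∑ S ∈ U.powersetCard (k + 1), f S =
      ∑ S ∈ U.powersetCard (k + 1), ∑ _e ∈ S, f S := by
    rw [Finset.mul_sum]
    refine Finset.sum_congr rfl fun S hS => ?_
    rw [Finset.sum_const, (Finset.mem_powersetCard.1 hS).2, smul_eq_mul]
  rw [h1, Finset.sum_sigma', Finset.sum_sigma']
  refine Finset.sum_bij' (fun p _ => ⟨p.1.erase p.2, p.2⟩) (fun p _ => ⟨insert p.2 p.1, p.2⟩)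
    ?_ ?_ ?_ ?_ ?_
  · rintro ⟨S, e⟩ h
    simp only [Finset.mem_sigma, Finset.mem_powersetCard, Finset.mem_sdiff] at h ⊢
    refine ⟨⟨(Finset.erase_subset _ _).trans h.1.1, ?_⟩, h.1.1 h.2, Finset.notMem_erase _ _⟩
    rw [Finset.card_erase_of_mem h.2, h.1.2, Nat.add_sub_cancel]
  · rintro ⟨T, e⟩ h
    simp only [Finset.mem_sigma, Finset.mem_powersetCard, Finset.mem_sdiff] at h ⊢
    refine ⟨⟨Finset.insert_subset h.2.1 h.1.1, ?_⟩, Finset.mem_insert_self _ _⟩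
    rw [Finset.card_insert_of_notMem h.2.2, h.1.2]
  · rintro ⟨S, e⟩ h
    simp only [Finset.mem_sigma] at h
    simp [Finset.insert_erase h.2]
  · rintro ⟨T, e⟩ h
    simp only [Finset.mem_sigma, Finset.mem_sdiff] at h
    simp [Finset.erase_insert h.2.2]
  · rintro ⟨S, e⟩ h
    simp only [Finset.mem_sigma] at h
    simp [Finset.insert_erase h.2]

section EdgeWeight

variable {V : Type*} [Fintype V] [DecidableEq V]

variable (V) in
/-- The possible edges of a simple graph on `V`. -/
def possibleEdges : Finset (Sym2 V) := Finset.univ.filter fun e => ¬ e.IsDiag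

theorem mem_possibleEdges {e : Sym2 V} : e ∈ possibleEdges V ↔ ¬ e.IsDiag := by
  simp [possibleEdges]

/-- The number of elements of the edge set `S` at the vertex `v`. -/
def edgeDegree (S : Finset (Sym2 V)) (v : V) : ℕ := (S.filter fun e => v ∈ e).card

/-- The number of ways to attach the edges of `S` to half-edges, `d v` of them at the
vertex `v`. -/
def edgeWeight (d : V → ℕ) (S : Finset (Sym2 V)) : ℕ :=
  ∏ v, (d v).descFactorial (edgeDegree S v)

/-- The total number of ways to attach `k` edges to half-edges, as `edgeWeight`. -/
def edgeWeightSum (d : V → ℕ) (k : ℕ) : ℕ :=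
  ∑ S ∈ (possibleEdges V).powersetCard k, edgeWeight d S

theorem sum_edgeDegree {S : Finset (Sym2 V)} (hS : S ⊆ possibleEdges V) :
    ∑ v, edgeDegree S v = 2 * S.card := by
  simp only [edgeDegree, Finset.card_filter]
  rw [Finset.sum_comm, mul_comm, ← smul_eq_mul, ← Finset.sum_const]
  refine Finset.sum_congr rfl fun e he => ?_
  rw [← Finset.card_filter, ← Sym2.card_toFinset_of_not_isDiag e (mem_possibleEdges.1 (hS he))]
  congr 1
  ext v
  simp

theorem edgeDegree_insert {W : Type*} [DecidableEq W] {e : Sym2 W} {T : Finset (Sym2 W)}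
    (he : e ∉ T) (v : W) :
    edgeDegree (insert e T) v = edgeDegree T v + if v ∈ e then 1 else 0 := by
  rw [edgeDegree, Finset.filter_insert]
  split_ifs with h
  · rw [Finset.card_insert_of_notMem (by simp [he])]
    rfl
  · rfl

/-- The new edge takes one of the free half-edges at each of its two distinct ends. -/
theorem edgeWeight_insert (d : V → ℕ) {e : Sym2 V} (hdiag : ¬ e.IsDiag) {T : Finset (Sym2 V)}
    (he : e ∉ T) : edgeWeight d (insert e T) =
      (e.map fun v => d v - edgeDegree T v).mul * edgeWeight d T := by
  have h1 : edgeWeight d (insert e T) =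
      (∏ v, if v ∈ e then d v - edgeDegree T v else 1) * edgeWeight d T := by
    rw [edgeWeight, edgeWeight, ← Finset.prod_mul_distrib]
    refine Finset.prod_congr rfl fun v _ => ?_
    rw [edgeDegree_insert he]
    split_ifs
    · rw [Nat.descFactorial_succ]
    · simp
  rw [h1]
  congr 1
  induction e with
  | h a b =>
    have hab : a ≠ b := by simpa using hdiag
    rw [← Finset.prod_filter]
    have h2 : (Finset.univ.filter fun v => v ∈ s(a, b)) = {a, b} := by
      ext v
      simp
    rw [h2, Finset.prod_pair hab]
    simp

theorem two_mul_sum_sym2_mul (r : V → ℕ) (T : Finset (Sym2 V)) :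
    2 * ∑ e ∈ possibleEdges V \ T, (e.map r).mul =
      ∑ p : V × V with p.1 ≠ p.2 ∧ s(p.1, p.2) ∉ T, r p.1 * r p.2 := by
  rw [← Finset.sum_fiberwise_of_maps_to (t := possibleEdges V \ T)
    (g := fun p : V × V => s(p.1, p.2)) (fun p hp => ?_), Finset.mul_sum]
  · refine Finset.sum_congr rfl fun e he => ?_
    rw [Finset.mem_sdiff, mem_possibleEdges] at he
    induction e with
    | h a b =>
      have hab : a ≠ b := by simpa using he.1
      have h2 : ((Finset.univ.filter fun p : V × V => p.1 ≠ p.2 ∧ s(p.1, p.2) ∉ T).filter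
          fun p => s(p.1, p.2) = s(a, b)) = {(a, b), (b, a)} := by
        ext ⟨x, y⟩
        simp only [Finset.mem_filter, Finset.mem_univ, true_and, Finset.mem_insert,
          Finset.mem_singleton, Prod.mk.injEq]
        constructor
        · rintro ⟨-, h⟩
          simpa using h
        · rintro (⟨rfl, rfl⟩ | ⟨rfl, rfl⟩)
          · exact ⟨⟨hab, he.2⟩, rfl⟩
          · exact ⟨⟨hab.symm, by rw [Sym2.eq_swap]; exact he.2⟩, Sym2.eq_swap⟩
      rw [h2, Finset.sum_pair (by simp [hab])]
      simp only [Sym2.map_mk, Sym2.mul_mk]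
      ring
  · simp only [Finset.mem_filter, Finset.mem_univ, true_and] at hp
    rw [Finset.mem_sdiff, mem_possibleEdges]
    simpa using hp

theorem two_mul_sum_sym2_mul_le (r : V → ℕ) (T : Finset (Sym2 V)) :
    2 * ∑ e ∈ possibleEdges V \ T, (e.map r).mul ≤ (∑ v, r v) ^ 2 := by
  rw [two_mul_sum_sym2_mul, sq, Finset.sum_mul_sum, ← Finset.sum_product']
  exact Finset.sum_le_sum_of_subset (Finset.subset_univ _)

/-- The pairs lost are loops, costing at most `M` per half-edge, and pairs joined in `T`: each
vertex has at most `M` such partners, with at most `M` half-edges each. -/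
theorem sq_sum_le_two_mul_sum_sym2_mul {M : ℕ} {r : V → ℕ} (hr : ∀ v, r v ≤ M)
    {T : Finset (Sym2 V)} (hT : ∀ v, edgeDegree T v ≤ M) :
    (∑ v, r v) ^ 2 ≤ 2 * ∑ e ∈ possibleEdges V \ T, (e.map r).mul +
      (M + M ^ 2) * ∑ v, r v := by
  have h1 : (∑ v, r v) ^ 2 = ∑ p : V × V, r p.1 * r p.2 := by
    rw [sq, Finset.sum_mul_sum, ← Finset.sum_product']
    rfl
  have hdiag : ∑ p : V × V with p.1 = p.2, r p.1 * r p.2 ≤ M * ∑ v, r v := by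
    rw [Finset.sum_filter, Fintype.sum_prod_type, Finset.mul_sum]
    refine Finset.sum_le_sum fun a _ => ?_
    simp only [Finset.sum_ite_eq, Finset.mem_univ, if_true]
    exact Nat.mul_le_mul_right _ (hr a)
  have hedge : ∑ p : V × V with s(p.1, p.2) ∈ T, r p.1 * r p.2 ≤ M ^ 2 * ∑ v, r v := by
    rw [Finset.sum_filter, Fintype.sum_prod_type, Finset.mul_sum]
    refine Finset.sum_le_sum fun a _ => ?_
    rw [← Finset.sum_filter]
    simp only
    rw [← Finset.mul_sum]
    have hc : (Finset.univ.filter fun b => s(a, b) ∈ T).card ≤ M := by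
      refine (Finset.card_le_card_of_injOn (fun b => s(a, b)) (fun b hb => ?_)
        (fun b _ c _ h => ?_)).trans (hT a)
      · simpa using hb
      · exact Sym2.congr_right.1 h
    calc r a * ∑ b with s(a, b) ∈ T, r b
        ≤ r a * ∑ b with s(a, b) ∈ T, M := by gcongr with b; exact hr b
      _ = r a * ((Finset.univ.filter fun b => s(a, b) ∈ T).card * M) := by
        rw [Finset.sum_const, smul_eq_mul]
      _ ≤ r a * (M * M) := by gcongr
      _ = M ^ 2 * r a := by ring
  have hsub : (Finset.univ : Finset (V × V)) ⊆
      ((Finset.univ.filter fun p : V × V => p.1 ≠ p.2 ∧ s(p.1, p.2) ∉ T) ∪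
        Finset.univ.filter fun p : V × V => p.1 = p.2) ∪
        Finset.univ.filter fun p : V × V => s(p.1, p.2) ∈ T := by
    intro p _
    simp only [Finset.mem_union, Finset.mem_filter, Finset.mem_univ, true_and]
    tauto
  rw [h1, two_mul_sum_sym2_mul]
  have h2 := Finset.sum_le_sum_of_subset (f := fun p : V × V => r p.1 * r p.2) hsub
  have h3 := Finset.sum_union_inter (f := fun p : V × V => r p.1 * r p.2)
    (s₁ := (Finset.univ.filter fun p : V × V => p.1 ≠ p.2 ∧ s(p.1, p.2) ∉ T) ∪
        Finset.univ.filter fun p : V × V => p.1 = p.2)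
    (s₂ := Finset.univ.filter fun p : V × V => s(p.1, p.2) ∈ T)
  have h4 := Finset.sum_union_inter (f := fun p : V × V => r p.1 * r p.2)
    (s₁ := Finset.univ.filter fun p : V × V => p.1 ≠ p.2 ∧ s(p.1, p.2) ∉ T)
    (s₂ := Finset.univ.filter fun p : V × V => p.1 = p.2)
  rw [add_mul]
  omega

/-- The factor `k + 1` counts the choices of the last edge added. -/
theorem succ_mul_edgeWeightSum_succ (d : V → ℕ) (k : ℕ) :
    (k + 1) * edgeWeightSum d (k + 1) =
      ∑ T ∈ (possibleEdges V).powersetCard k,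
        (∑ e ∈ possibleEdges V \ T, (e.map fun v => d v - edgeDegree T v).mul) *
          edgeWeight d T := by
  rw [edgeWeightSum, Finset.succ_mul_sum_powersetCard_succ]
  refine Finset.sum_congr rfl fun T _ => ?_
  rw [Finset.sum_mul]
  refine Finset.sum_congr rfl fun e he => ?_
  rw [Finset.mem_sdiff, mem_possibleEdges] at he
  exact edgeWeight_insert d he.1 he.2

theorem edgeDegree_le_of_edgeWeight_ne_zero {d : V → ℕ} {T : Finset (Sym2 V)}
    (h : edgeWeight d T ≠ 0) (v : V) : edgeDegree T v ≤ d v := by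
  by_contra hlt
  exact h (Finset.prod_eq_zero (Finset.mem_univ v)
    (Nat.descFactorial_eq_zero_iff_lt.2 (not_le.1 hlt)))

theorem sum_sub_edgeDegree {d : V → ℕ} {T : Finset (Sym2 V)} {k : ℕ}
    (hT : T ∈ (possibleEdges V).powersetCard k) (h : edgeWeight d T ≠ 0) :
    ∑ v, (d v - edgeDegree T v) = ∑ v, d v - 2 * k := by
  rw [Finset.mem_powersetCard] at hT
  rw [← hT.2, ← sum_edgeDegree hT.1,
    Finset.sum_tsub_distrib _ fun v _ => edgeDegree_le_of_edgeWeight_ne_zero h v]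

theorem succ_mul_edgeWeightSum_succ_le {d : V → ℕ} {m : ℕ} (hd : ∑ v, d v = 2 * m) (k : ℕ) :
    (k + 1) * edgeWeightSum d (k + 1) ≤ 2 * (m - k) ^ 2 * edgeWeightSum d k := by
  rw [succ_mul_edgeWeightSum_succ, edgeWeightSum, Finset.mul_sum]
  refine Finset.sum_le_sum fun T hT => ?_
  by_cases h : edgeWeight d T = 0
  · simp [h]
  refine Nat.mul_le_mul_right _ ?_
  have h1 := two_mul_sum_sym2_mul_le (fun v => d v - edgeDegree T v) T
  rw [sum_sub_edgeDegree hT h, hd, ← Nat.mul_sub, mul_pow] at h1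
  omega

theorem le_succ_mul_edgeWeightSum_succ {d : V → ℕ} {M m : ℕ} (hM : ∀ v, d v ≤ M)
    (hd : 2 * m + (M + M ^ 2) ≤ ∑ v, d v) (k : ℕ) :
    2 * (m - k) ^ 2 * edgeWeightSum d k ≤ (k + 1) * edgeWeightSum d (k + 1) := by
  rw [succ_mul_edgeWeightSum_succ, edgeWeightSum, Finset.mul_sum]
  refine Finset.sum_le_sum fun T hT => ?_
  by_cases h : edgeWeight d T = 0
  · simp [h]
  refine Nat.mul_le_mul_right _ ?_
  by_cases hk : m ≤ k
  · simp [Nat.sub_eq_zero_of_le hk]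
  have h1 := sq_sum_le_two_mul_sum_sym2_mul (r := fun v => d v - edgeDegree T v)
    (fun v => (Nat.sub_le _ _).trans (hM v))
    (fun v => (edgeDegree_le_of_edgeWeight_ne_zero h v).trans (hM v))
  rw [sum_sub_edgeDegree hT h] at h1
  obtain ⟨j, rfl⟩ : ∃ j, m = k + j := ⟨m - k, by omega⟩
  obtain ⟨t, ht⟩ : ∃ t, ∑ v, d v = 2 * (k + j) + (M + M ^ 2) + t :=
    ⟨∑ v, d v - (2 * (k + j) + (M + M ^ 2)), by omega⟩
  have e1 : ∑ v, d v - 2 * k = 2 * j + t + (M + M ^ 2) := by omega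
  rw [e1] at h1
  have e2 : k + j - k = j := by omega
  rw [e2]
  -- With `K = M + M ^ 2`, `h1` gives `2 * X ≥ (2 * j + t) * (2 * j + t + K) ≥ 4 * j ^ 2`: the spare
  -- half-edges absorb the loss.
  generalize ∑ e ∈ possibleEdges V \ T, (e.map fun v => d v - edgeDegree T v).mul = X at *
  nlinarith

theorem edgeWeightSum_zero (d : V → ℕ) : edgeWeightSum d 0 = 1 := by
  simp [edgeWeightSum, edgeWeight, edgeDegree]

theorem edgeWeightSum_le {d : V → ℕ} {m : ℕ} (hd : ∑ v, d v = 2 * m) :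
    edgeWeightSum d m ≤ 2 ^ m * m.factorial := by
  have key : ∀ k, k.factorial * edgeWeightSum d k ≤ 2 ^ k * (m.descFactorial k) ^ 2 := by
    intro k
    induction k with
    | zero => simp [edgeWeightSum_zero]
    | succ k ih =>
      calc (k + 1).factorial * edgeWeightSum d (k + 1)
          = k.factorial * ((k + 1) * edgeWeightSum d (k + 1)) := by
            rw [Nat.factorial_succ]; ring
        _ ≤ k.factorial * (2 * (m - k) ^ 2 * edgeWeightSum d k) :=
            Nat.mul_le_mul_left _ (succ_mul_edgeWeightSum_succ_le hd k)
        _ = 2 * (m - k) ^ 2 * (k.factorial * edgeWeightSum d k) := by ring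
        _ ≤ 2 * (m - k) ^ 2 * (2 ^ k * (m.descFactorial k) ^ 2) := Nat.mul_le_mul_left _ ih
        _ = 2 ^ (k + 1) * (m.descFactorial (k + 1)) ^ 2 := by
            rw [Nat.descFactorial_succ]; ring
  have h := key m
  rw [Nat.descFactorial_self] at h
  refine Nat.le_of_mul_le_mul_left (h.trans_eq ?_) m.factorial_pos
  ring

theorem le_edgeWeightSum {d : V → ℕ} {M m : ℕ} (hM : ∀ v, d v ≤ M)
    (hd : m = 0 ∨ 2 * m + (M + M ^ 2) ≤ ∑ v, d v) :
    2 ^ m * m.factorial ≤ edgeWeightSum d m := by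
  rcases hd with rfl | hd
  · simp [edgeWeightSum_zero]
  have key : ∀ k, 2 ^ k * (m.descFactorial k) ^ 2 ≤ k.factorial * edgeWeightSum d k := by
    intro k
    induction k with
    | zero => simp [edgeWeightSum_zero]
    | succ k ih =>
      calc 2 ^ (k + 1) * (m.descFactorial (k + 1)) ^ 2
          = 2 * (m - k) ^ 2 * (2 ^ k * (m.descFactorial k) ^ 2) := by
            rw [Nat.descFactorial_succ]; ring
        _ ≤ 2 * (m - k) ^ 2 * (k.factorial * edgeWeightSum d k) := Nat.mul_le_mul_left _ ih
        _ = k.factorial * (2 * (m - k) ^ 2 * edgeWeightSum d k) := by ring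
        _ ≤ k.factorial * ((k + 1) * edgeWeightSum d (k + 1)) :=
            Nat.mul_le_mul_left _ (le_succ_mul_edgeWeightSum_succ hM hd k)
        _ = (k + 1).factorial * edgeWeightSum d (k + 1) := by
            rw [Nat.factorial_succ]; ring
  have h := key m
  rw [Nat.descFactorial_self] at h
  refine Nat.le_of_mul_le_mul_left (Eq.trans_le ?_ h) m.factorial_pos
  ring

end EdgeWeight

/-! ### Numbers of graphs with prescribed or dominated degrees -/

section GraphCount

open Classical

variable {V : Type*} [Fintype V]

theorem edgeFinset_mem_powersetCard (G : SimpleGraph V) :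
    G.edgeFinset ∈ (possibleEdges V).powersetCard G.edgeFinset.card := by
  rw [Finset.mem_powersetCard]
  refine ⟨fun e he => ?_, rfl⟩
  rw [mem_possibleEdges]
  exact G.not_isDiag_of_mem_edgeFinset he

theorem card_edgeFinset_eq_ncard {W : Type*} (G : SimpleGraph W) [Fintype G.edgeSet] :
    G.edgeFinset.card = G.edgeSet.ncard := by
  rw [← SimpleGraph.coe_edgeFinset, Set.ncard_coe_finset]

theorem edgeDegree_edgeFinset (G : SimpleGraph V) (v : V) :
    edgeDegree G.edgeFinset v = G.degree v := by
  rw [← G.card_incidenceFinset_eq_degree, G.incidenceFinset_eq_filter, edgeDegree]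

/-- There are at most `2 ^ m m! / ∏ d_v!` graphs with degree sequence `d`, where `m` is the number
of edges. -/
theorem card_degree_eq_mul_prod_factorial_le {d : V → ℕ} {m : ℕ} (hd : ∑ v, d v = 2 * m) :
    (Finset.univ.filter fun G : SimpleGraph V => ∀ v, G.degree v = d v).card *
      ∏ v, (d v).factorial ≤ 2 ^ m * m.factorial := by
  refine le_trans ?_ (edgeWeightSum_le hd)
  have hw : ∀ G ∈ Finset.univ.filter fun G : SimpleGraph V => ∀ v, G.degree v = d v,
      ∏ v, (d v).factorial = edgeWeight d G.edgeFinset := by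
    intro G hG
    refine Finset.prod_congr rfl fun v _ => ?_
    rw [edgeDegree_edgeFinset, (Finset.mem_filter.1 hG).2 v, Nat.descFactorial_self]
  rw [← smul_eq_mul, ← Finset.sum_const, edgeWeightSum, Finset.sum_congr rfl hw,
    ← Finset.sum_image (f := edgeWeight d) (g := fun G : SimpleGraph V => G.edgeFinset)
      fun G _ H _ h => SimpleGraph.edgeFinset_inj.1 h]
  refine Finset.sum_le_sum_of_subset fun S hS => ?_
  obtain ⟨G, hG, rfl⟩ := Finset.mem_image.1 hS
  have hm : G.edgeFinset.card = m := by
    have h1 := G.sum_degrees_eq_twice_card_edges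
    rw [Finset.sum_congr rfl fun v _ => (Finset.mem_filter.1 hG).2 v, hd] at h1
    omega
  exact hm ▸ edgeFinset_mem_powersetCard G

/-- If `d ≤ M` and `∑ d_v ≥ 2 m + M + M ^ 2`, or if `m = 0`, there are at least `2 ^ m m! / ∏ d_v!` graphs with
`m` edges whose degrees are at most `d`. -/
theorem le_card_degree_le_mul_prod_factorial {d : V → ℕ} {M m : ℕ} (hM : ∀ v, d v ≤ M)
    (hd : m = 0 ∨ 2 * m + (M + M ^ 2) ≤ ∑ v, d v) :
    2 ^ m * m.factorial ≤ (Finset.univ.filter fun G : SimpleGraph V =>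
      G.edgeSet.ncard = m ∧ ∀ v, G.degree v ≤ d v).card * ∏ v, (d v).factorial := by
  refine (le_edgeWeightSum hM hd).trans ?_
  have hle : ∀ G ∈ Finset.univ.filter fun G : SimpleGraph V =>
      G.edgeSet.ncard = m ∧ ∀ v, G.degree v ≤ d v,
      edgeWeight d G.edgeFinset ≤ ∏ v, (d v).factorial := by
    intro G hG
    refine Finset.prod_le_prod' fun v _ => ?_
    rw [edgeDegree_edgeFinset,
      ← Nat.factorial_mul_descFactorial ((Finset.mem_filter.1 hG).2.2 v)]
    exact Nat.le_mul_of_pos_left _ (Nat.factorial_pos _)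
  rw [← smul_eq_mul, ← Finset.sum_const]
  refine le_trans ?_ (Finset.sum_le_sum hle)
  rw [← Finset.sum_image (f := edgeWeight d) (g := fun G : SimpleGraph V => G.edgeFinset)
      fun G _ H _ h => SimpleGraph.edgeFinset_inj.1 h, edgeWeightSum]
  refine Finset.sum_le_sum_of_ne_zero fun S hS hne => ?_
  have hSc := Finset.mem_powersetCard.1 hS
  obtain ⟨G, hGS⟩ : ∃ G : SimpleGraph V, G.edgeSet = S := by
    refine ⟨SimpleGraph.fromEdgeSet (S : Set (Sym2 V)), ?_⟩
    ext e
    rw [SimpleGraph.edgeSet_fromEdgeSet]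
    simp only [Set.mem_sdiff, Finset.mem_coe]
    exact ⟨fun h => h.1, fun h => ⟨h, mem_possibleEdges.1 (hSc.1 h)⟩⟩
  have hG : G.edgeFinset = S := by
    ext e
    rw [SimpleGraph.mem_edgeFinset, hGS, Finset.mem_coe]
  refine Finset.mem_image.2 ⟨G, ?_, hG⟩
  rw [Finset.mem_filter]
  refine ⟨Finset.mem_univ _, by rw [← card_edgeFinset_eq_ncard, hG]; exact hSc.2, fun v => ?_⟩
  rw [← edgeDegree_edgeFinset, hG]
  exact edgeDegree_le_of_edgeWeight_ne_zero hne v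

end GraphCount

/-! ### Elementary Stirling bounds -/

theorem factorial_le_exp_mul (m : ℕ) :
    (m.factorial : ℝ) ≤ Real.exp 1 * (m + 1) * Real.exp (m * Real.log m - m) := by
  rcases Nat.eq_zero_or_pos m with rfl | hm
  · simp
  have hm' : (0 : ℝ) < m := by exact_mod_cast hm
  obtain ⟨k, rfl⟩ : ∃ k, m = k + 1 := ⟨m - 1, by omega⟩
  -- The Stirling sequence decreases from its value `e / √2` at `1`; the remaining `√m` is bounded
  -- by `m + 1`.
  have h := Stirling.stirlingSeq'_antitone (Nat.zero_le k)
  simp only [Function.comp_apply, Nat.succ_eq_add_one, zero_add, Stirling.stirlingSeq_one] at h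
  rw [Stirling.stirlingSeq, div_le_iff₀ (by positivity)] at h
  have h1 : (((k + 1 : ℕ) : ℝ) / Real.exp 1) ^ (k + 1) =
      Real.exp ((k + 1 : ℕ) * Real.log (k + 1 : ℕ) - (k + 1 : ℕ)) := by
    rw [← Real.exp_log (div_pos hm' (Real.exp_pos 1)), ← Real.exp_nat_mul,
      Real.log_div hm'.ne' (Real.exp_pos 1).ne', Real.log_exp]
    congr 1
    ring
  rw [h1] at h
  refine h.trans ?_
  rw [Real.sqrt_mul (by norm_num), ← mul_assoc, ← mul_assoc,
    div_mul_cancel₀ _ (by positivity : √(2 : ℝ) ≠ 0)]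
  gcongr
  rw [Real.sqrt_le_left (by positivity)]
  nlinarith

theorem exp_mul_log_sub_le_factorial (m : ℕ) :
    Real.exp (m * Real.log m - m) ≤ m.factorial := by
  rcases Nat.eq_zero_or_pos m with rfl | hm
  · simp
  have hm' : (0 : ℝ) < m := by exact_mod_cast hm
  have h := Real.pow_div_factorial_le_exp (m : ℝ) hm'.le m
  rw [div_le_iff₀ (by positivity)] at h
  rw [Real.exp_sub, Real.exp_nat_mul, Real.exp_log hm', div_le_iff₀ (Real.exp_pos _), mul_comm]
  exact h

/-! ### Entropy bound for the number of graphs with a given degree histogram -/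

section EmpiricalDegree

open Classical

variable {V : Type*} [Fintype V] [Nonempty V]

theorem mass_empiricalDegree (G : SimpleGraph V) (i : ℕ) :
    (empiricalDegree G).mass i =
      ((Finset.univ.filter fun v => G.degree v = i).card : ℝ) / Fintype.card V := by
  rw [FiniteMeanDist.mass, empiricalDegree]
  simp only [PMF.map_apply, PMF.uniformOfFintype_apply]
  rw [tsum_fintype, ← Finset.sum_filter, Finset.sum_const, nsmul_eq_mul, ENNReal.toReal_mul,
    ENNReal.toReal_inv, ENNReal.toReal_natCast, ENNReal.toReal_natCast, div_eq_mul_inv]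
  congr 4
  ext v
  simp [eq_comm]

theorem hasSum_mass_empiricalDegree_mul (G : SimpleGraph V) (f : ℕ → ℝ) :
    HasSum (fun i => (empiricalDegree G).mass i * f i)
      ((∑ v, f (G.degree v)) / Fintype.card V) := by
  have h : HasSum (fun i => ∑ v, if i = G.degree v then f (G.degree v) else 0)
      (∑ v, f (G.degree v)) := hasSum_sum fun v _ => hasSum_ite_eq _ _
  have h2 := h.div_const (Fintype.card V : ℝ)
  have he : (fun i => (empiricalDegree G).mass i * f i) =
      fun i => (∑ v, if i = G.degree v then f (G.degree v) else 0) / (Fintype.card V : ℝ) := by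
    funext i
    rw [mass_empiricalDegree, div_mul_eq_mul_div]
    congr 1
    rw [Finset.card_filter, Nat.cast_sum, Finset.sum_mul]
    refine Finset.sum_congr rfl fun v _ => ?_
    by_cases hv : G.degree v = i
    · simp [hv]
    · simp [hv, Ne.symm hv]
  rwa [he]

theorem mean_empiricalDegree (G : SimpleGraph V) :
    (empiricalDegree G).mean = 2 * G.edgeSet.ncard / Fintype.card V := by
  have h := hasSum_mass_empiricalDegree_mul G (fun i => (i : ℝ))
  simp only [mul_comm ((empiricalDegree G).mass _)] at h
  rw [FiniteMeanDist.mean, h.tsum_eq]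
  congr 1
  rw [← card_edgeFinset_eq_ncard]
  exact_mod_cast G.sum_degrees_eq_twice_card_edges

theorem ncard_edgeSet_eq_of_empiricalDegree_eq {G H : SimpleGraph V}
    (h : empiricalDegree G = empiricalDegree H) : G.edgeSet.ncard = H.edgeSet.ncard := by
  have hcard : (0 : ℝ) < Fintype.card V := by exact_mod_cast Fintype.card_pos
  have h1 := mean_empiricalDegree G
  rw [h, mean_empiricalDegree H, div_left_inj' hcard.ne'] at h1
  exact_mod_cast (mul_left_cancel₀ two_ne_zero h1).symm

theorem summable_empiricalDegree (G : SimpleGraph V) :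
    Summable fun i : ℕ => (empiricalDegree G).mass i *
      Real.log ((i.factorial : ℝ) * (empiricalDegree G).mass i) :=
  (hasSum_mass_empiricalDegree_mul G
    fun i => Real.log ((i.factorial : ℝ) * (empiricalDegree G).mass i)).summable

theorem mass_empiricalDegree_degree_pos (G : SimpleGraph V) (v : V) :
    0 < (empiricalDegree G).mass (G.degree v) := by
  rw [mass_empiricalDegree]
  have : 0 < (Finset.univ.filter fun w => G.degree w = G.degree v).card :=
    Finset.card_pos.2 ⟨v, by simp⟩
  positivity

theorem exp_card_mul_entropySum (G : SimpleGraph V) :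
    Real.exp (Fintype.card V * (empiricalDegree G).entropySum) =
      ∏ v, (((G.degree v).factorial : ℝ) * (empiricalDegree G).mass (G.degree v)) := by
  have h := hasSum_mass_empiricalDegree_mul G
    fun i => Real.log ((i.factorial : ℝ) * (empiricalDegree G).mass i)
  have hc : (Fintype.card V : ℝ) ≠ 0 := by exact_mod_cast Fintype.card_ne_zero
  rw [FiniteMeanDist.entropySum, h.tsum_eq, mul_div_cancel₀ _ hc, Real.exp_sum]
  refine Finset.prod_congr rfl fun v _ => Real.exp_log ?_
  have := mass_empiricalDegree_degree_pos G v
  positivity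

/-- The number of graphs with a given empirical degree distribution. -/
theorem card_empiricalDegree_eq_le (G₀ : SimpleGraph V) :
    ({G : SimpleGraph V | empiricalDegree G = empiricalDegree G₀}.ncard : ℝ) *
      Real.exp (Fintype.card V * (empiricalDegree G₀).entropySum) ≤
        2 ^ G₀.edgeSet.ncard * (G₀.edgeSet.ncard.factorial : ℝ) := by
  set ν := empiricalDegree G₀ with hν
  set m := G₀.edgeSet.ncard with hm
  set 𝒢 := Finset.univ.filter fun G : SimpleGraph V => empiricalDegree G = ν with h𝒢
  have hcard : {G : SimpleGraph V | empiricalDegree G = ν}.ncard = 𝒢.card := by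
    rw [← Set.ncard_coe_finset]
    simp [h𝒢]
  rw [hcard]
  have hedge : ∀ G ∈ 𝒢, G.edgeSet.ncard = m := fun G hG =>
    ncard_edgeSet_eq_of_empiricalDegree_eq (Finset.mem_filter.1 hG).2
  let D : SimpleGraph V → V → Fin (Fintype.card V) := fun G v =>
    ⟨G.degree v, G.degree_lt_card_verts v⟩
  -- The same exponential is attained by every graph of the class, so it may be summed graph by
  -- graph and split along degree sequences.
  have h1 : (𝒢.card : ℝ) * Real.exp (Fintype.card V * ν.entropySum) =
      ∑ G ∈ 𝒢, ∏ v, (((G.degree v).factorial : ℝ) * ν.mass (G.degree v)) := by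
    rw [← nsmul_eq_mul, ← Finset.sum_const]
    refine Finset.sum_congr rfl fun G hG => ?_
    rw [← (Finset.mem_filter.1 hG).2, exp_card_mul_entropySum]
  have h2 : ∀ d : V → Fin (Fintype.card V),
      ∑ G ∈ 𝒢 with D G = d, ∏ v, (((G.degree v).factorial : ℝ) * ν.mass (G.degree v)) ≤
        (∏ v, ν.mass (d v)) * (2 ^ m * (m.factorial : ℝ)) := by
    intro d
    have hdeg : ∀ G ∈ 𝒢.filter fun G => D G = d, ∀ v, G.degree v = d v := by
      intro G hG v
      rw [← (Finset.mem_filter.1 hG).2]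
    have hprod : 0 ≤ ∏ v, ν.mass (d v) := Finset.prod_nonneg fun v _ => ν.mass_nonneg _
    rcases (𝒢.filter fun G => D G = d).eq_empty_or_nonempty with hE | ⟨G₁, hG₁⟩
    · rw [hE, Finset.sum_empty]
      positivity
    have hsum : ∑ v, (d v : ℕ) = 2 * m := by
      rw [← hedge G₁ (Finset.mem_filter.1 hG₁).1, ← card_edgeFinset_eq_ncard,
        ← G₁.sum_degrees_eq_twice_card_edges]
      exact Finset.sum_congr rfl fun v _ => (hdeg G₁ hG₁ v).symm
    have hb := card_degree_eq_mul_prod_factorial_le hsum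
    have hb' : ((Finset.univ.filter fun G : SimpleGraph V => ∀ v, G.degree v = d v).card : ℝ) *
      ∏ v, ((d v : ℕ).factorial : ℝ) ≤ 2 ^ m * m.factorial := by exact_mod_cast hb
    calc ∑ G ∈ 𝒢 with D G = d, ∏ v, (((G.degree v).factorial : ℝ) * ν.mass (G.degree v))
        = ∑ G ∈ 𝒢 with D G = d, (∏ v, ((d v : ℕ).factorial : ℝ)) * ∏ v, ν.mass (d v) := by
          refine Finset.sum_congr rfl fun G hG => ?_
          rw [← Finset.prod_mul_distrib]
          refine Finset.prod_congr rfl fun v _ => ?_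
          rw [hdeg G hG v]
      _ = (∏ v, ν.mass (d v)) * (((𝒢.filter fun G => D G = d).card : ℝ) *
            ∏ v, ((d v : ℕ).factorial : ℝ)) := by
          rw [Finset.sum_const, nsmul_eq_mul]
          ring
      _ ≤ (∏ v, ν.mass (d v)) *
            (((Finset.univ.filter fun G : SimpleGraph V => ∀ v, G.degree v = d v).card : ℝ) *
              ∏ v, ((d v : ℕ).factorial : ℝ)) := by
          gcongr
          intro G hG
          exact Finset.mem_filter.2 ⟨Finset.mem_univ _, hdeg G hG⟩
      _ ≤ _ := by gcongr
  -- The product measure of `ν` has total mass at most one; this replaces an estimate of the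
  -- multinomial coefficient.
  have h3 : ∑ d : V → Fin (Fintype.card V), ∏ v, ν.mass (d v) ≤ 1 := by
    have h4 := Finset.prod_univ_sum (fun _ : V => (Finset.univ : Finset (Fin (Fintype.card V))))
      (fun _ i => ν.mass i)
    rw [Fintype.piFinset_univ] at h4
    rw [← h4]
    refine Finset.prod_le_one (fun v _ => Finset.sum_nonneg fun i _ => ν.mass_nonneg _)
      fun v _ => ?_
    rw [Fin.sum_univ_eq_sum_range (fun i => ν.mass i)]
    exact sum_le_hasSum _ (fun i _ => ν.mass_nonneg i) ν.hasSum_mass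
  rw [h1, ← Finset.sum_fiberwise 𝒢 D]
  refine (Finset.sum_le_sum fun d _ => h2 d).trans ?_
  rw [← Finset.sum_mul]
  exact mul_le_of_le_one_left (by positivity) h3

end EmpiricalDegree

/-! ### Probabilities of single graphs -/

instance {V : Type*} [Finite V] : MeasurableSingletonClass (SimpleGraph V) where
  measurableSet_singleton G := by
    rw [← SimpleGraph.measurableEmbedding_edgeSet.measurableSet_image, Set.image_singleton]
    exact measurableSet_singleton _

theorem erdosRenyi_real_singleton {β : ℝ} (hβ : 0 < β) {n : ℕ} (hn : 0 < n) (hβn : β ≤ n)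
    (G : SimpleGraph (Fin n)) :
    (erdosRenyi β n).real {G} = (β / n) ^ G.edgeSet.ncard *
      (1 - β / n) ^ (n.choose 2 - G.edgeSet.ncard) := by
  have hn' : (0 : ℝ) < n := by exact_mod_cast hn
  have hmem : β / n ∈ Set.Icc (0 : ℝ) 1 := ⟨by positivity, (div_le_one hn').2 hβn⟩
  rw [measureReal_def, erdosRenyi, SimpleGraph.binomialRandom_singleton,
    Set.projIcc_of_mem zero_le_one hmem]
  simp

instance (β : ℝ) (n : ℕ) : IsProbabilityMeasure (erdosRenyi β n) := by
  unfold erdosRenyi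
  infer_instance

open Classical in
theorem erdosRenyi_real_eq_sum (β : ℝ) (n : ℕ) (P : SimpleGraph (Fin n) → Prop) :
    (erdosRenyi β n).real {G | P G} =
      ∑ G : SimpleGraph (Fin n) with P G, (erdosRenyi β n).real {G} := by
  rw [sum_measureReal_singleton]
  simp

theorem erdosRenyi_real_eq_ncard_mul (β : ℝ) (n : ℕ) {P : SimpleGraph (Fin n) → Prop} {x : ℝ}
    (h : ∀ G, P G → (erdosRenyi β n).real {G} = x) :
    (erdosRenyi β n).real {G | P G} = {G | P G}.ncard * x := by
  classical
  rw [erdosRenyi_real_eq_sum, Finset.sum_congr rfl fun G hG => h G (Finset.mem_filter.1 hG).2,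
    Finset.sum_const, nsmul_eq_mul, ← Set.ncard_coe_finset]
  simp

/-- The value of the rate function where the series converges. -/
noncomputable def realRate (β : ℝ) (μ : FiniteMeanDist) : ℝ := μ.entropySum + meanRate β μ.mean

theorem degreeRate_empiricalDegree {V : Type*} [Fintype V] [Nonempty V] (β : ℝ)
    (G : SimpleGraph V) : degreeRate β (empiricalDegree G) = (realRate β (empiricalDegree G) : EReal) :=
  degreeRate_of_summable β (summable_empiricalDegree G)

/-! ### Upper bound: point probabilities and summation over histograms -/

section Upper

open Classical

variable {β : ℝ} {n : ℕ} [Nonempty (Fin n)]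

theorem two_pow_mul_factorial_le (m : ℕ) :
    (2 : ℝ) ^ m * m.factorial ≤
      Real.exp 1 * (m + 1) * Real.exp (m * Real.log (2 * m) - m) := by
  rcases Nat.eq_zero_or_pos m with rfl | hm
  · simp
  have hm' : (0 : ℝ) < m := by exact_mod_cast hm
  calc (2 : ℝ) ^ m * m.factorial
      ≤ 2 ^ m * (Real.exp 1 * (m + 1) * Real.exp (m * Real.log m - m)) := by
        gcongr
        exact factorial_le_exp_mul m
    _ = Real.exp 1 * (m + 1) * (Real.exp (m * Real.log 2) * Real.exp (m * Real.log m - m)) := by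
        rw [Real.exp_nat_mul, Real.exp_log two_pos]
        ring
    _ = _ := by
        rw [← Real.exp_add, Real.log_mul two_ne_zero hm'.ne']
        congr 2
        ring

/-- Stirling's bound and `1 - x ≤ exp (-x)` produce `meanRate` at `2 * m / n`. The corrections in
the exponent arise because there are `n * (n - 1) / 2 - m` non-edges rather than `n ^ 2 / 2`. -/
theorem mul_edge_probability_le {β : ℝ} (hβ : 0 < β) {n : ℕ} (hn : 0 < n) (hβn : β ≤ n) {m : ℕ}
    (hmle : m ≤ n.choose 2) {K S : ℝ}
    (hK : K * Real.exp (n * S) ≤ 2 ^ m * (m.factorial : ℝ)) :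
    K * ((β / n) ^ m * (1 - β / n) ^ (n.choose 2 - m)) ≤
      Real.exp 1 * (n ^ 2 + 1) * Real.exp (β / 2 + β / 2 * (2 * m / n) -
        n * (S + meanRate β (2 * m / n))) := by
  have hn' : (0 : ℝ) < n := by exact_mod_cast hn
  have hN : ((n.choose 2 : ℕ) : ℝ) = n * (n - 1) / 2 := Nat.cast_choose_two ℝ n
  have hmn : (m : ℝ) ≤ n ^ 2 := by
    have : (m : ℝ) ≤ (n.choose 2 : ℕ) := by exact_mod_cast hmle
    rw [hN] at this
    nlinarith
  have hcount : K ≤ Real.exp 1 * (n ^ 2 + 1) *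
      Real.exp (m * Real.log (2 * m) - m - n * S) := by
    have h1 := hK.trans (two_pow_mul_factorial_le m)
    rw [← le_div_iff₀ (Real.exp_pos _), mul_div_assoc, ← Real.exp_sub] at h1
    refine h1.trans ?_
    gcongr
  have h0 : 0 ≤ 1 - β / n := by
    rw [sub_nonneg, div_le_one hn']
    exact hβn
  have hp1 : (β / n) ^ m = Real.exp (m * Real.log (β / n)) := by
    rw [Real.exp_nat_mul, Real.exp_log (by positivity)]
  have hp2 : (1 - β / n) ^ (n.choose 2 - m) ≤ Real.exp (-(β * (n - 1) / 2) + β * m / n) := by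
    have h1 : 1 - β / n ≤ Real.exp (-(β / n)) := by
      have := Real.add_one_le_exp (-(β / n))
      linarith
    refine (pow_le_pow_left₀ h0 h1 _).trans_eq ?_
    rw [← Real.exp_nat_mul, Nat.cast_sub hmle, hN]
    congr 1
    field_simp
    ring
  rw [hp1]
  have hnn : 0 ≤ (1 - β / n) ^ (n.choose 2 - m) := pow_nonneg h0 _
  generalize (1 - β / n) ^ (n.choose 2 - m) = Q at hp2 hnn ⊢
  calc K * (Real.exp (m * Real.log (β / n)) * Q)
      ≤ (Real.exp 1 * (n ^ 2 + 1) * Real.exp (m * Real.log (2 * m) - m - n * S)) *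
        (Real.exp (m * Real.log (β / n)) * Real.exp (-(β * (n - 1) / 2) + β * m / n)) := by
        gcongr
    _ = Real.exp 1 * (n ^ 2 + 1) * Real.exp ((m * Real.log (2 * m) - m - n * S) +
        (m * Real.log (β / n) + (-(β * (n - 1) / 2) + β * m / n))) := by
        rw [Real.exp_add (m * Real.log (2 * m) - m - n * S), Real.exp_add (m * Real.log (β / n))]
        ring
    _ = _ := by
        congr 2
        rw [meanRate]
        rcases Nat.eq_zero_or_pos m with h0 | h0
        · rw [h0]
          simp only [Nat.cast_zero, mul_zero, zero_mul, zero_div]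
          field_simp
          ring
        · have h0' : (0 : ℝ) < m := by exact_mod_cast h0
          rw [show 2 * (m : ℝ) / n * β = 2 * m * (β / n) by ring,
            Real.log_mul (x := 2 * (m : ℝ)) (y := β / n) (by positivity) (by positivity)]
          generalize Real.log (β / n) = u
          field_simp
          ring

theorem erdosRenyi_real_empiricalDegree_eq_le (hβ : 0 < β) (hβn : β ≤ n)
    (G₀ : SimpleGraph (Fin n)) :
    (erdosRenyi β n).real {G | empiricalDegree G = empiricalDegree G₀} ≤
      Real.exp 1 * (n ^ 2 + 1) * Real.exp (β / 2 + β / 2 * (empiricalDegree G₀).mean -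
        n * realRate β (empiricalDegree G₀)) := by
  have hn : 0 < n := Fin.pos_iff_nonempty.2 inferInstance
  have hmle : G₀.edgeSet.ncard ≤ n.choose 2 := by
    have := SimpleGraph.card_edgeFinset_le_card_choose_two (G := G₀)
    rwa [Fintype.card_fin, card_edgeFinset_eq_ncard] at this
  have hcount := card_empiricalDegree_eq_le G₀
  rw [Fintype.card_fin] at hcount
  have h := mul_edge_probability_le hβ hn hβn hmle hcount
  rw [realRate, mean_empiricalDegree, Fintype.card_fin]
  refine le_trans (le_of_eq ?_) h
  refine erdosRenyi_real_eq_ncard_mul β n fun G hG => ?_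
  rw [erdosRenyi_real_singleton hβ hn hβn, ncard_edgeSet_eq_of_empiricalDegree_eq hG]

theorem natFloor_mul_mass_empiricalDegree (G : SimpleGraph (Fin n)) (i : ℕ) :
    ⌊n * (empiricalDegree G).mass i⌋₊ = (Finset.univ.filter fun v => G.degree v = i).card := by
  have hn : 0 < n := Fin.pos_iff_nonempty.2 inferInstance
  have hn' : (n : ℝ) ≠ 0 := by exact_mod_cast hn.ne'
  rw [mass_empiricalDegree, Fintype.card_fin, mul_div_cancel₀ _ hn', Nat.floor_natCast]

theorem natCast_floor_mul_mass_empiricalDegree (G : SimpleGraph (Fin n)) (i : ℕ) :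
    (⌊n * (empiricalDegree G).mass i⌋₊ : ℝ) = n * (empiricalDegree G).mass i := by
  have hn : 0 < n := Fin.pos_iff_nonempty.2 inferInstance
  have hn' : (n : ℝ) ≠ 0 := by exact_mod_cast hn.ne'
  rw [natFloor_mul_mass_empiricalDegree, mass_empiricalDegree, Fintype.card_fin,
    mul_div_cancel₀ _ hn']

theorem mass_empiricalDegree_eq_zero (G : SimpleGraph (Fin n)) {i : ℕ} (hi : n ≤ i) :
    (empiricalDegree G).mass i = 0 := by
  rw [mass_empiricalDegree, Finset.filter_false_of_mem, Finset.card_empty, Nat.cast_zero, zero_div]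
  intro v _ h
  have := G.degree_lt_card_verts v
  rw [Fintype.card_fin] at this
  omega

theorem natCast_mul_mean_empiricalDegree (G : SimpleGraph (Fin n)) :
    n * (empiricalDegree G).mean =
      ∑ i : Fin n, ((i : ℕ) + 1 : ℝ) * ⌊n * (empiricalDegree G).mass (i + 1)⌋₊ := by
  simp only [natCast_floor_mul_mass_empiricalDegree]
  rw [Fin.sum_univ_eq_sum_range (fun i => ((i : ℝ) + 1) * (n * (empiricalDegree G).mass (i + 1))),
    FiniteMeanDist.mean, tsum_eq_sum (s := Finset.range (n + 1)) fun i hi => ?_,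
    Finset.sum_range_succ', Nat.cast_zero, zero_mul, add_zero, Finset.mul_sum]
  · refine Finset.sum_congr rfl fun i _ => ?_
    push_cast
    ring
  · rw [mass_empiricalDegree_eq_zero G (by rw [Finset.mem_range] at hi; omega), mul_zero]

/-- The sum over the possible empirical degree distributions of `e ^ (- s * total degree)` is
bounded uniformly in the number of vertices. -/
theorem sum_exp_neg_mul_mean_le {s : ℝ} (hs : 0 < s) (T : Finset FiniteMeanDist)
    (hT : ∀ ν ∈ T, ∃ G : SimpleGraph (Fin n), empiricalDegree G = ν) :
    ∑ ν ∈ T, Real.exp (-s * (n * ν.mean)) ≤ Real.exp (1 / (1 - Real.exp (-s)) ^ 2) := by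
  set q := Real.exp (-s) with hq
  have hq0 : 0 < q := Real.exp_pos _
  have hq1 : q < 1 := Real.exp_lt_one_iff.2 (by linarith)
  -- Counts of the positive degrees determine the law, so the sum is dominated by one over a box of
  -- count vectors, which factorizes into geometric sums as for partitions.
  let h : FiniteMeanDist → Fin n → ℕ := fun ν i => ⌊n * ν.mass (i + 1)⌋₊
  have hn : 0 < n := Fin.pos_iff_nonempty.2 inferInstance
  have hn' : (0 : ℝ) < n := by exact_mod_cast hn
  have hval : ∀ ν ∈ T, Real.exp (-s * (n * ν.mean)) =
      ∏ i : Fin n, (q ^ ((i : ℕ) + 1)) ^ h ν i := by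
    intro ν hν
    obtain ⟨G, rfl⟩ := hT ν hν
    rw [natCast_mul_mean_empiricalDegree, Finset.mul_sum, Real.exp_sum]
    refine Finset.prod_congr rfl fun i _ => ?_
    rw [hq, ← Real.exp_nat_mul, ← Real.exp_nat_mul]
    congr 1
    push_cast
    ring
  have hinj : Set.InjOn h T := by
    intro μ hμ ν hν heq
    obtain ⟨G, rfl⟩ := hT μ hμ
    obtain ⟨H, rfl⟩ := hT ν hν
    refine FiniteMeanDist.ext_mass fun i hi => ?_
    rcases le_or_gt n i with hni | hni
    · rw [mass_empiricalDegree_eq_zero G hni, mass_empiricalDegree_eq_zero H hni]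
    · have h1 := congrFun heq ⟨i - 1, by omega⟩
      simp only [h, Nat.sub_add_cancel (Nat.one_le_iff_ne_zero.2 hi)] at h1
      have h2 : (n : ℝ) * (empiricalDegree G).mass i = n * (empiricalDegree H).mass i := by
        rw [← natCast_floor_mul_mass_empiricalDegree G, h1,
          natCast_floor_mul_mass_empiricalDegree H]
      exact mul_left_cancel₀ hn'.ne' h2
  have hmem : T.image h ⊆ Fintype.piFinset fun _ : Fin n => Finset.range (n + 1) := by
    intro f hf
    obtain ⟨ν, hν, rfl⟩ := Finset.mem_image.1 hf
    obtain ⟨G, rfl⟩ := hT ν hν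
    rw [Fintype.mem_piFinset]
    intro i
    rw [Finset.mem_range, Nat.lt_succ_iff]
    simp only [h, natFloor_mul_mass_empiricalDegree]
    exact (Finset.card_le_univ _).trans_eq (Fintype.card_fin n)
  have hgeom : ∀ i : Fin n, ∑ k ∈ Finset.range (n + 1), (q ^ ((i : ℕ) + 1)) ^ k ≤
      Real.exp (q ^ ((i : ℕ) + 1) / (1 - q)) := by
    intro i
    set x := q ^ ((i : ℕ) + 1) with hx
    have hx0 : 0 < x := pow_pos hq0 _
    have hxq : x ≤ q := by
      rw [hx, pow_succ]
      exact mul_le_of_le_one_left hq0.le (pow_le_one₀ hq0.le hq1.le)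
    have hx1 : x < 1 := hxq.trans_lt hq1
    have h1 : ∑ k ∈ Finset.range (n + 1), x ^ k ≤ (1 - x)⁻¹ :=
      sum_le_hasSum _ (fun k _ => by positivity) (hasSum_geometric_of_lt_one hx0.le hx1)
    have h2 : (1 - x)⁻¹ = x / (1 - x) + 1 := by
      have : (1 - x) ≠ 0 := by linarith
      field_simp
      ring
    have h3 : x / (1 - x) ≤ x / (1 - q) := by
      have : 0 < 1 - q := by linarith
      gcongr
    have h4 := Real.add_one_le_exp (x / (1 - q))
    linarith
  have hsum : ∑ i : Fin n, q ^ ((i : ℕ) + 1) / (1 - q) ≤ 1 / (1 - q) ^ 2 := by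
    have h1q : 0 < 1 - q := by linarith
    rw [← Finset.sum_div, Fin.sum_univ_eq_sum_range (fun i => q ^ (i + 1))]
    have h1 : ∑ i ∈ Finset.range n, q ^ (i + 1) ≤ (1 - q)⁻¹ := by
      refine le_trans (Finset.sum_le_sum fun i _ => ?_)
        (sum_le_hasSum (Finset.range n) (fun k _ => by positivity)
          (hasSum_geometric_of_lt_one hq0.le hq1))
      exact pow_le_pow_of_le_one hq0.le hq1.le (Nat.le_succ i)
    calc (∑ i ∈ Finset.range n, q ^ (i + 1)) / (1 - q) ≤ (1 - q)⁻¹ / (1 - q) := by gcongr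
      _ = 1 / (1 - q) ^ 2 := by field_simp
  calc ∑ ν ∈ T, Real.exp (-s * (n * ν.mean))
      = ∑ f ∈ T.image h, ∏ i : Fin n, (q ^ ((i : ℕ) + 1)) ^ f i := by
        rw [Finset.sum_image hinj]
        exact Finset.sum_congr rfl hval
    _ ≤ ∑ f ∈ Fintype.piFinset fun _ : Fin n => Finset.range (n + 1),
          ∏ i : Fin n, (q ^ ((i : ℕ) + 1)) ^ f i :=
        Finset.sum_le_sum_of_subset_of_nonneg hmem fun f _ _ => by positivity
    _ = ∏ i : Fin n, ∑ k ∈ Finset.range (n + 1), (q ^ ((i : ℕ) + 1)) ^ k :=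
        (Finset.prod_univ_sum (fun _ : Fin n => Finset.range (n + 1))
          fun i k => (q ^ ((i : ℕ) + 1)) ^ k).symm
    _ ≤ ∏ i : Fin n, Real.exp (q ^ ((i : ℕ) + 1) / (1 - q)) :=
        Finset.prod_le_prod (fun i _ => by positivity) fun i _ => hgeom i
    _ = Real.exp (∑ i : Fin n, q ^ ((i : ℕ) + 1) / (1 - q)) := (Real.exp_sum _ _).symm
    _ ≤ _ := Real.exp_le_exp.2 hsum

/-- One of the `n` copies of the rate absorbs the correction `β / 2 * mean`. Of the other `n - 1`, a
share `1 - ε` is bounded by `a` and a share `ε` by the mean, which makes the sum over histograms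
converge. -/
theorem erdosRenyi_real_empiricalDegree_mem_le (hβ : 0 < β) (hn2 : 2 ≤ n) (hβn : β ≤ n)
    {A : Set FiniteMeanDist} {a ε : ℝ} (ha : ∀ μ ∈ A, (a : EReal) ≤ degreeRate β μ) (hε : 0 < ε)
    (hε1 : ε ≤ 1) :
    (erdosRenyi β n).real {G | empiricalDegree G ∈ A} ≤
      Real.exp 1 * (n ^ 2 + 1) * Real.exp (β / 2 + β * (Real.exp β - 1) / 2 +
        1 / (1 - Real.exp (-(ε / 2))) ^ 2 -
        (n - 1) * ((1 - ε) * a - ε * (β * (Real.exp 2 - 1) / 2))) := by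
  have hn' : (2 : ℝ) ≤ n := by exact_mod_cast hn2
  set c₁ := β * (Real.exp β - 1) / 2 with hc₁
  set c₂ := β * (Real.exp 2 - 1) / 2 with hc₂
  set T := (Finset.univ.filter fun G : SimpleGraph (Fin n) => empiricalDegree G ∈ A).image
    empiricalDegree with hT
  have hTG : ∀ ν ∈ T, ν ∈ A ∧ ∃ G : SimpleGraph (Fin n), empiricalDegree G = ν := by
    intro ν hν
    obtain ⟨G, hG, rfl⟩ := Finset.mem_image.1 hν
    exact ⟨(Finset.mem_filter.1 hG).2, G, rfl⟩
  have hsub : {G : SimpleGraph (Fin n) | empiricalDegree G ∈ A} ⊆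
      ⋃ ν ∈ T, {G | empiricalDegree G = ν} := by
    intro G hG
    simp only [Set.mem_iUnion]
    exact ⟨empiricalDegree G, Finset.mem_image.2
      ⟨G, Finset.mem_filter.2 ⟨Finset.mem_univ _, hG⟩, rfl⟩, rfl⟩
  have hterm : ∀ ν ∈ T, (erdosRenyi β n).real {G | empiricalDegree G = ν} ≤
      Real.exp 1 * (n ^ 2 + 1) * Real.exp (β / 2 + c₁ - (n - 1) * ((1 - ε) * a - ε * c₂)) *
        Real.exp (-(ε / 2) * (n * ν.mean)) := by
    intro ν hν
    obtain ⟨hA, G₀, rfl⟩ := hTG ν hν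
    refine (erdosRenyi_real_empiricalDegree_eq_le hβ hβn G₀).trans ?_
    rw [mul_assoc _ (Real.exp _) (Real.exp _), ← Real.exp_add]
    gcongr
    have ha' := ha _ hA
    rw [degreeRate_empiricalDegree, EReal.coe_le_coe_iff] at ha'
    -- Slope `β / 2` cancels the correction term; slope `1` supplies the decay in the mean.
    have h1 := entropy_mean_le_of_summable hβ (summable_empiricalDegree G₀) (β / 2)
    have h2 := entropy_mean_le_of_summable hβ (summable_empiricalDegree G₀) 1
    rw [← realRate] at h1 h2
    rw [mul_div_cancel₀ _ two_ne_zero, ← hc₁] at h1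
    rw [mul_one, one_mul, ← hc₂] at h2
    have hm := (empiricalDegree G₀).mean_nonneg
    generalize realRate β (empiricalDegree G₀) = r at *
    generalize (empiricalDegree G₀).mean = x at *
    have h3 : (n - 1) * ((1 - ε) * a + ε * (x - c₂)) ≤ (n - 1) * r := by
      have h4 : (1 - ε) * a ≤ (1 - ε) * r := mul_le_mul_of_nonneg_left ha' (by linarith)
      have h5 : ε * (x - c₂) ≤ ε * r := mul_le_mul_of_nonneg_left h2 hε.le
      exact mul_le_mul_of_nonneg_left (by linarith) (by linarith)
    -- This turns `(n - 1) * ε * x` into the required `(ε / 2) * n * x`, and needs `2 ≤ n`.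
    have h6 : 0 ≤ ε * x * (n / 2 - 1) := mul_nonneg (mul_nonneg hε.le hm) (by linarith)
    nlinarith
  refine (measureReal_mono hsub (measure_ne_top _ _)).trans ?_
  refine (measureReal_biUnion_finset_le T _).trans ?_
  refine (Finset.sum_le_sum hterm).trans ?_
  rw [← Finset.mul_sum]
  have hK := sum_exp_neg_mul_mean_le (n := n) (half_pos hε) T fun ν hν => (hTG ν hν).2
  refine (mul_le_mul_of_nonneg_left hK (by positivity)).trans_eq ?_
  rw [mul_assoc _ (Real.exp _) (Real.exp _), ← Real.exp_add]
  congr 2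
  ring

end Upper

/-! ### Exponential scale and the upper bound -/

section LogProbability

variable {Ω : Type*} [MeasurableSpace Ω] {P : Measure Ω} [IsFiniteMeasure P] {s : Set Ω}

theorem log_div_le_of_real_le_exp {t c : ℝ} (ht : 0 < t) (h : P.real s ≤ Real.exp (t * c)) :
    ENNReal.log (P s) / (t : EReal) ≤ (c : EReal) := by
  rw [EReal.div_le_iff_le_mul (EReal.coe_pos.2 ht) (EReal.coe_ne_top t), ← EReal.coe_mul]
  have h1 : P s ≤ ENNReal.ofReal (Real.exp (t * c)) := by
    rw [← ofReal_measureReal]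
    exact ENNReal.ofReal_le_ofReal h
  refine (ENNReal.log_le_log h1).trans_eq ?_
  rw [ENNReal.log_ofReal_of_pos (Real.exp_pos _), Real.log_exp]

theorem le_log_div_of_exp_le_real {t c : ℝ} (ht : 0 < t) (h : Real.exp (t * c) ≤ P.real s) :
    (c : EReal) ≤ ENNReal.log (P s) / (t : EReal) := by
  rw [EReal.le_div_iff_mul_le (EReal.coe_pos.2 ht) (EReal.coe_ne_top t), ← EReal.coe_mul]
  have h1 : ENNReal.ofReal (Real.exp (t * c)) ≤ P s := by
    rw [← ofReal_measureReal (μ := P) (s := s)]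
    exact ENNReal.ofReal_le_ofReal h
  refine le_trans (le_of_eq ?_) (ENNReal.log_le_log h1)
  rw [ENNReal.log_ofReal_of_pos (Real.exp_pos _), Real.log_exp, mul_comm]

end LogProbability

theorem eventually_mul_sq_add_one_le_exp (C : ℝ) {κ : ℝ} (hκ : 0 < κ) :
    ∀ᶠ x : ℝ in atTop, C * (x ^ 2 + 1) ≤ Real.exp (κ * x) := by
  filter_upwards [eventually_ge_atTop 1, eventually_ge_atTop (12 * |C| / κ ^ 3)] with x hx1 hx2
  have h1 := Real.pow_div_factorial_le_exp (κ * x) (by positivity) 3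
  have h2 : (Nat.factorial 3 : ℝ) = 6 := by norm_num [Nat.factorial]
  rw [h2] at h1
  refine le_trans ?_ h1
  rw [div_le_iff₀ (by positivity)] at hx2
  have h3 : C * (x ^ 2 + 1) ≤ |C| * (2 * x ^ 2) := by
    have : x ^ 2 + 1 ≤ 2 * x ^ 2 := by nlinarith
    exact mul_le_mul (le_abs_self C) this (by positivity) (abs_nonneg C)
  have h4 : 12 * |C| * x ^ 2 ≤ x * κ ^ 3 * x ^ 2 := by gcongr
  rw [le_div_iff₀ (by norm_num), mul_pow]
  nlinarith

theorem limsup_log_erdosRenyi_le {β : ℝ} (hβ : 0 < β) (A : Set FiniteMeanDist) :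
    limsup (fun n : ℕ+ =>
        ENNReal.log (erdosRenyi β n {G | empiricalDegree G ∈ A}) / ((n : ℝ) : EReal)) atTop
      ≤ -(⨅ μ ∈ A, degreeRate β μ) := by
  rw [← EReal.le_of_forall_lt_iff_le]
  intro z hz
  obtain ⟨z', hz', hz'z⟩ := EReal.lt_iff_exists_real_btwn.1 hz
  rw [EReal.coe_lt_coe_iff] at hz'z
  set a : ℝ := -z' with ha
  have hrate : ∀ μ ∈ A, (a : EReal) ≤ degreeRate β μ := by
    intro μ hμ
    have h1 : (a : EReal) < ⨅ μ ∈ A, degreeRate β μ := by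
      rw [ha, EReal.coe_neg]
      exact EReal.neg_lt_comm.1 hz'
    exact h1.le.trans (iInf₂_le μ hμ)
  set c₂ := β * (Real.exp 2 - 1) / 2 with hc₂
  obtain ⟨ε, hε0, hε1, hε⟩ : ∃ ε : ℝ, 0 < ε ∧ ε ≤ 1 ∧ 0 < z + ((1 - ε) * a - ε * c₂) := by
    -- As `a = -z'`, the required quantity is `z - z' - ε * (a + c₂)`, and this `ε` costs at most
    -- half of the gap.
    refine ⟨min 1 ((z - z') / (2 * (|a + c₂| + 1))), ?_, min_le_left _ _, ?_⟩
    · exact lt_min one_pos (div_pos (by linarith) (by positivity))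
    · set ε := min 1 ((z - z') / (2 * (|a + c₂| + 1)))
      have h1 : ε ≤ (z - z') / (2 * (|a + c₂| + 1)) := min_le_right _ _
      rw [le_div_iff₀ (by positivity)] at h1
      have h0 : 0 < ε := lt_min one_pos (div_pos (by linarith) (by positivity))
      have h2 : ε * (a + c₂) ≤ ε * |a + c₂| := by gcongr; exact le_abs_self _
      nlinarith
  set b := (1 - ε) * a - ε * c₂ with hb
  set D := β / 2 + β * (Real.exp β - 1) / 2 + 1 / (1 - Real.exp (-(ε / 2))) ^ 2 with hD
  have hcast : Tendsto (fun n : ℕ+ => ((n : ℕ) : ℝ)) atTop atTop :=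
    tendsto_natCast_atTop_atTop.comp tendsto_PNat_val_atTop_atTop
  have hev := hcast.eventually (eventually_mul_sq_add_one_le_exp
    (Real.exp 1 * Real.exp (D + b)) hε)
  refine limsup_le_of_le (h := ?_)
  filter_upwards [hev, hcast.eventually (eventually_ge_atTop 2),
    hcast.eventually (eventually_ge_atTop β)] with n hn1 hn2 hn3
  have hn2' : 2 ≤ (n : ℕ) := by exact_mod_cast hn2
  refine log_div_le_of_real_le_exp (by linarith) ?_
  refine (erdosRenyi_real_empiricalDegree_mem_le hβ hn2' hn3 hrate hε0 hε1).trans ?_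
  have he : Real.exp (D - (((n : ℕ) : ℝ) - 1) * b) =
      Real.exp (D + b) * Real.exp (-(((n : ℕ) : ℝ) * b)) := by
    rw [← Real.exp_add]
    congr 1
    ring
  have he2 : Real.exp (((n : ℕ) : ℝ) * z) =
      Real.exp ((z + b) * ((n : ℕ) : ℝ)) * Real.exp (-(((n : ℕ) : ℝ) * b)) := by
    rw [← Real.exp_add]
    congr 1
    ring
  rw [he, he2, ← mul_assoc]
  gcongr
  linarith

/-! ### Double counting of graphs and rearrangements -/

section Counting

open Classical

theorem exists_fun_card_fiber {W : Type*} [Fintype W] (h : W → ℕ) {s : ℕ} (hs : ∑ w, h w = s) :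
    ∃ g : Fin s → W, ∀ w, (Finset.univ.filter fun j => g j = w).card = h w := by
  have hc : Fintype.card (Σ w, Fin (h w)) = s := by simp [hs]
  let e := Fintype.equivFinOfCardEq hc
  refine ⟨fun j => (e.symm j).1, fun w => ?_⟩
  rw [← Fintype.card_fin (h w), ← Fintype.card_subtype]
  refine Fintype.card_congr ?_
  refine (e.symm.subtypeEquiv (p := fun j => (e.symm j).1 = w)
    (q := fun x : Σ w, Fin (h w) => x.1 = w) fun _ => Iff.rfl).trans ?_
  exact Equiv.sigmaSubtype w

variable {V : Type*} [Fintype V]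

/-- Each such `x` arises from `e` by handing the missing units one by one to vertices. -/
theorem card_le_pow_of_le_of_sum_eq {M : ℕ} (e : V → ℕ) (D : ℕ) :
    (Finset.univ.filter fun x : V → Fin (M + 1) =>
      (∀ v, e v ≤ x v) ∧ ∑ v, (x v : ℕ) = D).card ≤ Fintype.card V ^ (D - ∑ v, e v) := by
  rw [← Fintype.card_fin (D - ∑ v, e v), ← Fintype.card_fun, ← Finset.card_univ]
  -- `Fin.ofNat` reduces modulo `M + 1`; this is harmless, as preimages are only needed for values
  -- already below `M + 1`.
  refine Finset.card_le_card_of_surjOn (fun (g : Fin (D - ∑ v, e v) → V) v =>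
    Fin.ofNat (M + 1) (e v + (Finset.univ.filter fun j => g j = v).card)) fun x hx => ?_
  obtain ⟨hle, hD⟩ := (Finset.mem_filter.1 hx).2
  have hs : ∑ v, ((x v : ℕ) - e v) = D - ∑ v, e v := by
    rw [Finset.sum_tsub_distrib _ fun v _ => hle v, hD]
  obtain ⟨g, hg⟩ := exists_fun_card_fiber _ hs
  refine ⟨g, by simp, ?_⟩
  ext v
  simp only [Fin.val_ofNat]
  rw [hg v, Nat.add_sub_cancel' (hle v), Nat.mod_eq_of_lt (x v).2]

/-- The permutations `σ` for which `d ∘ σ` is a given function. -/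
theorem card_perm_comp_eq_le {ι : Type*} [Fintype ι] [DecidableEq ι] (d x : V → ι) :
    (Finset.univ.filter fun σ : Equiv.Perm V => d ∘ σ = x).card ≤
      ∏ i, (Finset.univ.filter fun v => d v = i).card.factorial := by
  rcases (Finset.univ.filter fun σ : Equiv.Perm V => d ∘ σ = x).eq_empty_or_nonempty with h | h
  · rw [h, Finset.card_empty]
    exact Nat.zero_le _
  obtain ⟨σ₀, hσ₀⟩ := h
  have hσ₀' : d ∘ σ₀ = x := (Finset.mem_filter.1 hσ₀).2
  -- Two permutations with `d ∘ σ = x` differ by an element of the stabilizer of `d`, whose order is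
  -- the product of the fibre factorials.
  have hst := DomMulAct.stabilizer_card d
  simp only [Fintype.card_subtype] at hst
  rw [← hst]
  refine Finset.card_le_card_of_injOn (fun σ => σ * σ₀⁻¹) (fun σ hσ => ?_) fun σ _ τ _ h =>
    mul_right_cancel h
  have hσ' : d ∘ σ = d ∘ σ₀ := (Finset.mem_filter.1 hσ).2.trans hσ₀'.symm
  simp only [Finset.coe_filter, Finset.mem_univ, true_and, Set.mem_ofPred_eq]
  ext v
  have := congrFun hσ' (σ₀⁻¹ v)
  simpa using this

/-- Counting graphs whose degree sequence is dominated by a rearrangement of `d`. -/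
theorem factorial_mul_le_ncard_degree_le_perm {M m : ℕ} (d : V → Fin (M + 1))
    (hd : m = 0 ∨ 2 * m + (M + M ^ 2) ≤ ∑ v, (d v : ℕ)) :
    (Fintype.card V).factorial * (2 ^ m * m.factorial) ≤
      {G : SimpleGraph V | G.edgeSet.ncard = m ∧
        ∃ σ : Equiv.Perm V, ∀ v, G.degree v ≤ (d (σ v) : ℕ)}.ncard *
      (Fintype.card V ^ (∑ v, (d v : ℕ) - 2 * m) *
        ∏ i, (Finset.univ.filter fun v => d v = i).card.factorial) *
        ∏ v, (d v : ℕ).factorial := by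
  set 𝒢 := Finset.univ.filter fun G : SimpleGraph V => G.edgeSet.ncard = m ∧
    ∃ σ : Equiv.Perm V, ∀ v, G.degree v ≤ (d (σ v) : ℕ) with h𝒢
  have hcard : {G : SimpleGraph V | G.edgeSet.ncard = m ∧
        ∃ σ : Equiv.Perm V, ∀ v, G.degree v ≤ (d (σ v) : ℕ)}.ncard = 𝒢.card := by
    rw [← Set.ncard_coe_finset]
    simp [h𝒢]
  rw [hcard]
  set H := ∏ i, (Finset.univ.filter fun v => d v = i).card.factorial with hH
  have h1 : ∀ σ : Equiv.Perm V, 2 ^ m * m.factorial ≤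
      (𝒢.filter fun G => ∀ v, G.degree v ≤ (d (σ v) : ℕ)).card * ∏ v, (d v : ℕ).factorial := by
    intro σ
    have hd' : m = 0 ∨ 2 * m + (M + M ^ 2) ≤ ∑ v, (d (σ v) : ℕ) := by
      rwa [Equiv.sum_comp σ fun v => (d v : ℕ)]
    have h := le_card_degree_le_mul_prod_factorial (d := fun v => (d (σ v) : ℕ)) (M := M)
      (fun v => Nat.lt_succ_iff.1 (d (σ v)).2) hd'
    rw [Equiv.prod_comp σ fun v => (d v : ℕ).factorial] at h
    refine h.trans (Nat.mul_le_mul_right _ (Finset.card_le_card fun G hG => ?_))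
    rw [Finset.mem_filter] at hG
    rw [Finset.mem_filter, h𝒢, Finset.mem_filter]
    exact ⟨⟨Finset.mem_univ _, hG.2.1, σ, hG.2.2⟩, hG.2.2⟩
  -- A fixed graph is dominated by few rearrangements `x` of `d`, since only `∑ d - 2 * m` units are
  -- free, and each `x` comes from at most `H` permutations.
  have h2 : ∀ G ∈ 𝒢, (Finset.univ.filter fun σ : Equiv.Perm V =>
      ∀ v, G.degree v ≤ (d (σ v) : ℕ)).card ≤
        Fintype.card V ^ (∑ v, (d v : ℕ) - 2 * m) * H := by
    intro G hG
    have hsum : ∑ v, G.degree v = 2 * m := by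
      rw [G.sum_degrees_eq_twice_card_edges, card_edgeFinset_eq_ncard, (Finset.mem_filter.1 hG).2.1]
    have h3 := card_le_pow_of_le_of_sum_eq (M := M) (fun v => G.degree v) (∑ v, (d v : ℕ))
    rw [hsum] at h3
    rw [mul_comm]
    refine (Finset.card_le_mul_card_image_of_maps_to (f := fun σ : Equiv.Perm V => d ∘ σ)
      (t := Finset.univ.filter fun x : V → Fin (M + 1) =>
        (∀ v, G.degree v ≤ x v) ∧ ∑ v, (x v : ℕ) = ∑ v, (d v : ℕ)) (fun σ hσ => ?_) H
      fun x _ => ?_).trans (Nat.mul_le_mul_left _ h3)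
    · rw [Finset.mem_filter]
      exact ⟨Finset.mem_univ _, (Finset.mem_filter.1 hσ).2, Equiv.sum_comp σ fun v => (d v : ℕ)⟩
    · refine (Finset.card_le_card fun σ hσ => ?_).trans (card_perm_comp_eq_le d x)
      exact Finset.mem_filter.2 ⟨Finset.mem_univ _, (Finset.mem_filter.1 hσ).2⟩
  have h4 : ∑ σ : Equiv.Perm V, (𝒢.filter fun G => ∀ v, G.degree v ≤ (d (σ v) : ℕ)).card =
      ∑ G ∈ 𝒢, (Finset.univ.filter fun σ : Equiv.Perm V => ∀ v, G.degree v ≤ (d (σ v) : ℕ)).card :=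
    Finset.sum_card_bipartiteAbove_eq_sum_card_bipartiteBelow
      (fun (σ : Equiv.Perm V) (G : SimpleGraph V) => ∀ v, G.degree v ≤ (d (σ v) : ℕ))
  calc (Fintype.card V).factorial * (2 ^ m * m.factorial)
      = ∑ _σ : Equiv.Perm V, 2 ^ m * m.factorial := by
        rw [Finset.sum_const, Finset.card_univ, Fintype.card_perm, smul_eq_mul]
    _ ≤ ∑ σ : Equiv.Perm V, (𝒢.filter fun G => ∀ v, G.degree v ≤ (d (σ v) : ℕ)).card *
          ∏ v, (d v : ℕ).factorial := Finset.sum_le_sum fun σ _ => h1 σ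
    _ = (∑ G ∈ 𝒢, (Finset.univ.filter fun σ : Equiv.Perm V =>
          ∀ v, G.degree v ≤ (d (σ v) : ℕ)).card) * ∏ v, (d v : ℕ).factorial := by
        rw [← h4, Finset.sum_mul]
    _ ≤ (∑ _G ∈ 𝒢, Fintype.card V ^ (∑ v, (d v : ℕ) - 2 * m) * H) *
          ∏ v, (d v : ℕ).factorial :=
        Nat.mul_le_mul_right _ (Finset.sum_le_sum h2)
    _ = _ := by rw [Finset.sum_const, smul_eq_mul]

end Counting

/-! ### Lower bound for the neighbourhood of a histogram -/

section Lower

/-- A vertex where `f` and `g` differ contributes at most `1` on the left and at least `1` on the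
right. -/
theorem abs_card_filter_sub_card_filter_le {V : Type*} [Fintype V] (f g : V → ℕ)
    (hfg : ∀ v, f v ≤ g v) (i : ℕ) :
    |((Finset.univ.filter fun v => f v = i).card : ℝ) -
      ((Finset.univ.filter fun v => g v = i).card : ℝ)| ≤ ∑ v, (g v : ℝ) - ∑ v, (f v : ℝ) := by
  rw [Finset.card_filter, Finset.card_filter, Nat.cast_sum, Nat.cast_sum,
    ← Finset.sum_sub_distrib, ← Finset.sum_sub_distrib]
  refine (Finset.abs_sum_le_sum_abs _ _).trans (Finset.sum_le_sum fun v _ => ?_)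
  rcases (hfg v).eq_or_lt with h | h
  · simp [h]
  · have h1 : (f v : ℝ) + 1 ≤ g v := by exact_mod_cast h
    have h2 : |(((if f v = i then 1 else 0 : ℕ) : ℝ)) - ((if g v = i then 1 else 0 : ℕ) : ℝ)| ≤ 1 := by
      split_ifs <;> simp
    linarith

open Classical in
theorem dist_empiricalDegree_le {V : Type*} [Fintype V] [Nonempty V] {M : ℕ}
    {ν : FiniteMeanDist} (hν : ∀ i, M < i → ν.mass i = 0) (G : SimpleGraph V)
    (x : V → Fin (M + 1)) (hx : ∀ v, G.degree v ≤ (x v : ℕ)) :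
    dist (empiricalDegree G) ν ≤
      M * (M + 1) * (∑ v, ((x v : ℕ) : ℝ) - 2 * G.edgeSet.ncard) / Fintype.card V +
      ∑ i : Fin (M + 1), ((i : ℕ) : ℝ) *
        |((Finset.univ.filter fun v => x v = i).card : ℝ) / Fintype.card V - ν.mass i| := by
  have hcard : (0 : ℝ) < Fintype.card V := by exact_mod_cast Fintype.card_pos
  have hG : ∀ i, M < i → (empiricalDegree G).mass i = 0 := by
    intro i hi
    rw [mass_empiricalDegree, Finset.filter_false_of_mem, Finset.card_empty, Nat.cast_zero,
      zero_div]
    intro v _ h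
    have := hx v
    have := (x v).2
    omega
  have hsum : ∑ v, (G.degree v : ℝ) = 2 * G.edgeSet.ncard := by
    rw [← card_edgeFinset_eq_ncard]
    exact_mod_cast G.sum_degrees_eq_twice_card_edges
  set Δ := ∑ v, ((x v : ℕ) : ℝ) - 2 * G.edgeSet.ncard with hΔ
  have hΔ0 : 0 ≤ Δ := by
    rw [hΔ, ← hsum, sub_nonneg]
    exact Finset.sum_le_sum fun v _ => by exact_mod_cast hx v
  have hterm : ∀ i : Fin (M + 1), ((i : ℕ) : ℝ) * |(empiricalDegree G).mass i - ν.mass i| ≤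
      M * (Δ / Fintype.card V) + ((i : ℕ) : ℝ) *
        |((Finset.univ.filter fun v => x v = i).card : ℝ) / Fintype.card V - ν.mass i| := by
    intro i
    have hiM : ((i : ℕ) : ℝ) ≤ M := by exact_mod_cast Nat.lt_succ_iff.1 i.2
    have h1 := abs_card_filter_sub_card_filter_le (fun v => G.degree v) (fun v => (x v : ℕ)) hx i
    rw [hsum, ← hΔ] at h1
    simp only [Fin.val_inj] at h1
    have h2 : |(empiricalDegree G).mass i -
        ((Finset.univ.filter fun v => x v = i).card : ℝ) / Fintype.card V| ≤
          Δ / Fintype.card V := by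
      rw [mass_empiricalDegree, ← sub_div, abs_div, abs_of_pos hcard]
      gcongr
    have h3 := abs_sub_le ((empiricalDegree G).mass i)
      (((Finset.univ.filter fun v => x v = i).card : ℝ) / Fintype.card V) (ν.mass i)
    calc ((i : ℕ) : ℝ) * |(empiricalDegree G).mass i - ν.mass i|
        ≤ ((i : ℕ) : ℝ) * (Δ / Fintype.card V +
          |((Finset.univ.filter fun v => x v = i).card : ℝ) / Fintype.card V - ν.mass i|) := by
          gcongr
          linarith
      _ ≤ _ := by
          rw [mul_add]
          gcongr
  rw [FiniteMeanDist.dist_def, tsum_eq_sum (s := Finset.range (M + 1)) fun i hi => ?_,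
    ← Fin.sum_univ_eq_sum_range (fun i => (i : ℝ) * |(empiricalDegree G).mass i - ν.mass i|)]
  · refine (Finset.sum_le_sum fun i _ => hterm i).trans_eq ?_
    rw [Finset.sum_add_distrib, Finset.sum_const, Finset.card_univ, Fintype.card_fin, nsmul_eq_mul]
    push_cast
    ring
  · have hi' : M < i := by rw [Finset.mem_range] at hi; omega
    rw [hG i hi', hν i hi', sub_zero, abs_zero, mul_zero]

/-- Both factorials are bounded below by `k ^ k * exp (-k)`, and `log p ≥ 1 - 1 / p` handles the
absent edges; the last term of the exponent is `o(n)`. -/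
theorem exp_le_factorial_mul_edge_probability {β : ℝ} (hβ : 0 < β) {n : ℕ} (hn : β < n) (m : ℕ) :
    Real.exp (n * Real.log n - n * meanRate β (2 * m / n) - n +
        n * (β / 2 - β / 2 / (1 - β / n))) ≤
      (n.factorial : ℝ) * (2 ^ m * m.factorial) *
        ((β / n) ^ m * (1 - β / n) ^ (n.choose 2 - m)) := by
  have hn' : (0 : ℝ) < n := hβ.trans hn
  have hp : 0 < 1 - β / n := by
    rw [sub_pos, div_lt_one hn']
    exact hn
  have hp1 : 1 - β / n ≤ 1 := by
    have : 0 < β / n := by positivity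
    linarith
  have h1 : Real.exp (-(n * (β / 2 / (1 - β / n)))) ≤ (1 - β / n) ^ (n.choose 2 - m) := by
    refine le_trans ?_ (pow_le_pow_of_le_one hp.le hp1 (Nat.sub_le _ m))
    have hlog := Real.one_sub_inv_le_log_of_pos hp
    rw [← Real.exp_log (pow_pos hp _), Real.log_pow, Real.exp_le_exp]
    have hN : ((n.choose 2 : ℕ) : ℝ) = n * (n - 1) / 2 := Nat.cast_choose_two ℝ n
    have h3 : ((n.choose 2 : ℕ) : ℝ) * (1 - (1 - β / n)⁻¹) ≤
        ((n.choose 2 : ℕ) : ℝ) * Real.log (1 - β / n) :=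
      mul_le_mul_of_nonneg_left hlog (Nat.cast_nonneg _)
    refine le_trans ?_ h3
    have h4 : 1 - (1 - β / n)⁻¹ = -(β / n / (1 - β / n)) := by
      have := hp.ne'
      generalize β / n = p at this
      field_simp
      ring
    rw [h4, hN]
    have h5 : 0 < β / n / (1 - β / n) := by positivity
    have h6 : n * (β / 2 / (1 - β / n)) = n ^ 2 / 2 * (β / n / (1 - β / n)) := by
      field_simp
    rw [h6]
    nlinarith
  have h2 : (β / n) ^ m = Real.exp (m * Real.log (β / n)) := by
    rw [Real.exp_nat_mul, Real.exp_log (by positivity)]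
  have h3 : (2 : ℝ) ^ m = Real.exp (m * Real.log 2) := by
    rw [Real.exp_nat_mul, Real.exp_log two_pos]
  have hexp : n * Real.log n - n * meanRate β (2 * m / n) - n +
        n * (β / 2 - β / 2 / (1 - β / n)) =
      (n * Real.log n - n) + (m * Real.log 2 + (m * Real.log m - m)) +
        (m * Real.log (β / n) + -(n * (β / 2 / (1 - β / n)))) := by
    rw [meanRate]
    generalize β / 2 / (1 - β / n) = w
    rcases Nat.eq_zero_or_pos m with h0 | h0
    · rw [h0]
      simp only [Nat.cast_zero, mul_zero, zero_mul, zero_div]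
      ring
    · have h0' : (0 : ℝ) < m := by exact_mod_cast h0
      rw [show 2 * (m : ℝ) / n * β = 2 * m * (β / n) by ring,
        Real.log_mul (x := 2 * (m : ℝ)) (y := β / n) (by positivity) (by positivity),
        Real.log_mul two_ne_zero h0'.ne']
      generalize Real.log (β / n) = u
      field_simp
      ring
  rw [hexp, Real.exp_add, Real.exp_add, Real.exp_add, Real.exp_add, h2, h3]
  gcongr
  · exact exp_mul_log_sub_le_factorial n
  · exact exp_mul_log_sub_le_factorial m

/-- Stirling's upper bound for each of the `M + 1` factorials costs only a logarithmic error;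
rescaling `h i` by `n` yields the term `n log n`. -/
theorem histogram_weight_le_exp {n M c k : ℕ} (hn : 0 < n) (h : Fin (M + 1) → ℕ)
    (hsum : ∑ i, h i = n) (hk : k ≤ c) :
    (n : ℝ) ^ k * (∏ i, ((h i).factorial : ℝ)) * ∏ i : Fin (M + 1), ((i : ℕ).factorial : ℝ) ^ h i ≤
      Real.exp (n * Real.log n - n + (n * ∑ i : Fin (M + 1), ((h i : ℝ) / n) *
        Real.log (((i : ℕ).factorial : ℝ) * ((h i : ℝ) / n))) +
        ((M + 1) * (1 + Real.log (n + 1)) + c * Real.log n)) := by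
  have hn' : (0 : ℝ) < n := by exact_mod_cast hn
  have hn1 : (1 : ℝ) ≤ n := by exact_mod_cast hn
  have h1 : (n : ℝ) ^ k ≤ Real.exp (c * Real.log n) := by
    rw [Real.exp_nat_mul, Real.exp_log hn']
    exact pow_le_pow_right₀ hn1 hk
  have hle : ∀ i, h i ≤ n := fun i =>
    hsum ▸ Finset.single_le_sum (f := h) (fun j _ => Nat.zero_le _) (Finset.mem_univ i)
  have h2 : ∀ i, ((h i).factorial : ℝ) ≤
      Real.exp (1 + Real.log (n + 1) + (h i * Real.log (h i) - h i)) := by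
    intro i
    refine (factorial_le_exp_mul (h i)).trans ?_
    rw [Real.exp_add, Real.exp_add, Real.exp_log (by positivity)]
    have : (h i : ℝ) ≤ n := by exact_mod_cast hle i
    gcongr
  have h3 : ∀ i : Fin (M + 1), ((i : ℕ).factorial : ℝ) ^ h i =
      Real.exp (h i * Real.log ((i : ℕ).factorial)) := by
    intro i
    rw [Real.exp_nat_mul, Real.exp_log (by positivity)]
  have h4 : ∀ i : Fin (M + 1), n * (((h i : ℝ) / n) *
        Real.log (((i : ℕ).factorial : ℝ) * ((h i : ℝ) / n))) =
      h i * Real.log ((i : ℕ).factorial) + h i * Real.log (h i) - h i * Real.log n := by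
    intro i
    rcases Nat.eq_zero_or_pos (h i) with h0 | h0
    · simp [h0]
    · have h0' : (0 : ℝ) < h i := by exact_mod_cast h0
      have hf : (0 : ℝ) < ((i : ℕ).factorial : ℝ) := by positivity
      rw [Real.log_mul hf.ne' (by positivity), Real.log_div h0'.ne' hn'.ne']
      field_simp
      ring
  have hsum' : ∑ i, (h i : ℝ) = n := by exact_mod_cast hsum
  calc (n : ℝ) ^ k * (∏ i, ((h i).factorial : ℝ)) *
        ∏ i : Fin (M + 1), ((i : ℕ).factorial : ℝ) ^ h i
      ≤ Real.exp (c * Real.log n) *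
        (∏ i : Fin (M + 1), Real.exp (1 + Real.log (n + 1) + (h i * Real.log (h i) - h i))) *
        ∏ i : Fin (M + 1), Real.exp (h i * Real.log ((i : ℕ).factorial)) := by
        simp only [h3]
        gcongr with i
        exact h2 i
    _ = _ := by
        rw [← Real.exp_sum, ← Real.exp_sum, ← Real.exp_add, ← Real.exp_add]
        congr 1
        rw [Finset.mul_sum, Finset.sum_congr rfl fun i _ => h4 i]
        simp only [Finset.sum_add_distrib, Finset.sum_sub_distrib, Finset.sum_const,
          Finset.card_univ, Fintype.card_fin, nsmul_eq_mul, ← Finset.sum_mul, hsum']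
        push_cast
        ring

open Classical in
/-- A lower bound for the probability of a set which contains a neighbourhood of a histogram. -/
theorem exp_le_erdosRenyi_real {β : ℝ} (hβ : 0 < β) {n : ℕ} [Nonempty (Fin n)] (hβn : β < n)
    {M m c : ℕ} (h : Fin (M + 1) → ℕ) (hsum : ∑ i, h i = n)
    (hm : m = 0 ∨ 2 * m + (M + M ^ 2) ≤ ∑ i : Fin (M + 1), (i : ℕ) * h i)
    (hc : ∑ i : Fin (M + 1), (i : ℕ) * h i ≤ 2 * m + c)
    {ν : FiniteMeanDist} (hν : ∀ i, M < i → ν.mass i = 0) {A : Set FiniteMeanDist}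
    (hA : ∀ μ, dist μ ν ≤ M * (M + 1) * c / n +
      ∑ i : Fin (M + 1), ((i : ℕ) : ℝ) * |(h i : ℝ) / n - ν.mass i| → μ ∈ A) :
    Real.exp (n * (-(∑ i : Fin (M + 1), ((h i : ℝ) / n) *
        Real.log (((i : ℕ).factorial : ℝ) * ((h i : ℝ) / n))) - meanRate β (2 * m / n) +
        (β / 2 - β / 2 / (1 - β / n)) -
        ((M + 1) * (1 + Real.log (n + 1)) + c * Real.log n) / n)) ≤
      (erdosRenyi β n).real {G | empiricalDegree G ∈ A} := by
  have hn : 0 < n := Fin.pos_iff_nonempty.2 inferInstance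
  have hn' : (0 : ℝ) < n := by exact_mod_cast hn
  obtain ⟨d, hd⟩ := exists_fun_card_fiber h hsum
  have hfib : ∀ i, (Finset.univ.filter fun v => d v = i).card = h i := fun i => by
    rw [← hd i]
    congr!
  have hdsum : ∑ v, (d v : ℕ) = ∑ i : Fin (M + 1), (i : ℕ) * h i := by
    rw [← Finset.sum_fiberwise Finset.univ d]
    refine Finset.sum_congr rfl fun i _ => ?_
    rw [Finset.sum_congr rfl fun v hv => by rw [(Finset.mem_filter.1 hv).2], Finset.sum_const,
      hfib, smul_eq_mul, mul_comm]
  have hdprod : ∏ v, (d v : ℕ).factorial = ∏ i : Fin (M + 1), (i : ℕ).factorial ^ h i := by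
    rw [← Finset.prod_fiberwise Finset.univ d]
    refine Finset.prod_congr rfl fun i _ => ?_
    rw [Finset.prod_congr rfl fun v hv => by rw [(Finset.mem_filter.1 hv).2], Finset.prod_const,
      hfib]
  have hcount := factorial_mul_le_ncard_degree_le_perm d (m := m) (by rwa [hdsum])
  rw [Fintype.card_fin, hdsum, hdprod] at hcount
  simp only [hfib] at hcount
  set x : ℝ := (β / n) ^ m * (1 - β / n) ^ (n.choose 2 - m) with hx
  have hx0 : 0 ≤ x := by
    have : 0 ≤ 1 - β / n := by
      rw [sub_nonneg, div_le_one hn']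
      exact hβn.le
    positivity
  set 𝒢 : Set (SimpleGraph (Fin n)) := {G | G.edgeSet.ncard = m ∧
    ∃ σ : Equiv.Perm (Fin n), ∀ v, G.degree v ≤ (d (σ v) : ℕ)} with h𝒢
  -- The counted graphs miss at most `c` of the prescribed half-edges, so their laws lie in the ball
  -- assumed to be inside `A`.
  have hsub : 𝒢 ⊆ {G | empiricalDegree G ∈ A} := by
    rintro G ⟨hGm, σ, hσ⟩
    refine hA _ ((dist_empiricalDegree_le hν G (fun v => d (σ v)) hσ).trans ?_)
    have hfib' : ∀ i, (Finset.univ.filter fun v => d (σ v) = i).card = h i := by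
      intro i
      rw [← hfib i]
      exact Finset.card_equiv σ (by simp)
    have hs : ∑ v, ((d (σ v) : ℕ) : ℝ) - 2 * m ≤ c := by
      rw [Equiv.sum_comp σ fun v => ((d v : ℕ) : ℝ), sub_le_iff_le_add']
      exact_mod_cast hdsum.trans_le hc
    simp only [hfib', hGm, Fintype.card_fin]
    gcongr
  have hP : (erdosRenyi β n).real 𝒢 = 𝒢.ncard * x :=
    erdosRenyi_real_eq_ncard_mul β n fun G hG => by
      rw [erdosRenyi_real_singleton hβ hn hβn.le, hG.1]
  refine le_trans ?_ (measureReal_mono hsub (measure_ne_top _ _))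
  rw [hP]
  have hcount' : (n.factorial : ℝ) * (2 ^ m * m.factorial) ≤ 𝒢.ncard *
      ((n : ℝ) ^ (∑ i : Fin (M + 1), (i : ℕ) * h i - 2 * m) * ∏ i, ((h i).factorial : ℝ)) *
        ∏ i : Fin (M + 1), ((i : ℕ).factorial : ℝ) ^ h i := by
    exact_mod_cast hcount
  have hB := histogram_weight_le_exp (c := c)
    (k := ∑ i : Fin (M + 1), (i : ℕ) * h i - 2 * m) hn h hsum (by omega)
  have hL := exp_le_factorial_mul_edge_probability hβ hβn m
  rw [← hx] at hL
  set B : ℝ := (n : ℝ) ^ (∑ i : Fin (M + 1), (i : ℕ) * h i - 2 * m) *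
    (∏ i, ((h i).factorial : ℝ)) * ∏ i : Fin (M + 1), ((i : ℕ).factorial : ℝ) ^ h i with hBdef
  have hfin := calc
    _ ≤ (n.factorial : ℝ) * (2 ^ m * m.factorial) * x := hL
    _ ≤ (𝒢.ncard * B) * x := by
      refine mul_le_mul_of_nonneg_right ?_ hx0
      exact hcount'.trans_eq (mul_assoc _ _ _)
    _ = (𝒢.ncard * x) * B := by ring
    _ ≤ _ := mul_le_mul_of_nonneg_left hB (mul_nonneg (Nat.cast_nonneg _) hx0)
  rw [← div_le_iff₀ (Real.exp_pos _), ← Real.exp_sub] at hfin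
  refine le_trans (le_of_eq ?_) hfin
  congr 1
  generalize β / 2 / (1 - β / n) = w
  field_simp
  ring

end Lower

/-! ### Lower bound: finite support, then truncation -/

section LowerBound

theorem tendsto_log_natCast_div_atTop :
    Tendsto (fun n : ℕ => Real.log n / n) atTop (𝓝 0) := by
  have h := (Real.isLittleO_log_id_atTop.tendsto_div_nhds_zero).comp
    (tendsto_natCast_atTop_atTop (R := ℝ))
  exact h

theorem tendsto_log_natCast_add_one_div_atTop :
    Tendsto (fun n : ℕ => Real.log (n + 1) / n) atTop (𝓝 0) := by
  have h1 := (tendsto_add_atTop_iff_nat 1).2 tendsto_log_natCast_div_atTop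
  have h2 : Tendsto (fun n : ℕ => 1 + 1 / (n : ℝ)) atTop (𝓝 (1 + 0)) :=
    tendsto_const_nhds.add tendsto_one_div_atTop_nhds_zero_nat
  have h3 := h1.mul h2
  rw [zero_mul] at h3
  refine h3.congr' ?_
  filter_upwards [eventually_gt_atTop 0] with n hn
  have hn' : (0 : ℝ) < n := by exact_mod_cast hn
  push_cast
  field_simp

/-- The histogram obtained by rounding `n ν` down, with the rest put at `0`. -/
noncomputable def roundedHistogram (ν : FiniteMeanDist) (M n : ℕ) : Fin (M + 1) → ℕ :=
  Fin.cons (n - ∑ j : Fin M, ⌊ν.mass (j + 1) * n⌋₊) fun j => ⌊ν.mass (j + 1) * n⌋₊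

theorem sum_natFloor_mass_mul_le (ν : FiniteMeanDist) (M n : ℕ) :
    ∑ j : Fin M, ⌊ν.mass (j + 1) * n⌋₊ ≤ n := by
  have h1 : ∑ j : Fin M, ν.mass (j + 1) ≤ 1 := by
    rw [Fin.sum_univ_eq_sum_range (fun j => ν.mass (j + 1))]
    have h2 : ∑ i ∈ Finset.range (M + 1), ν.mass i ≤ 1 :=
      sum_le_hasSum _ (fun i _ => ν.mass_nonneg i) ν.hasSum_mass
    rw [Finset.sum_range_succ'] at h2
    linarith [ν.mass_nonneg 0]
  have h3 : ((∑ j : Fin M, ⌊ν.mass (j + 1) * n⌋₊ : ℕ) : ℝ) ≤ n := by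
    rw [Nat.cast_sum]
    calc ∑ j : Fin M, (⌊ν.mass (j + 1) * n⌋₊ : ℝ) ≤ ∑ j : Fin M, ν.mass (j + 1) * n :=
          Finset.sum_le_sum fun j _ =>
            Nat.floor_le (mul_nonneg (ν.mass_nonneg _) (Nat.cast_nonneg n))
      _ = (∑ j : Fin M, ν.mass (j + 1)) * n := by rw [Finset.sum_mul]
      _ ≤ n := mul_le_of_le_one_left (Nat.cast_nonneg n) h1
  exact_mod_cast h3

theorem sum_roundedHistogram (ν : FiniteMeanDist) (M n : ℕ) :
    ∑ i, roundedHistogram ν M n i = n := by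
  rw [Fin.sum_univ_succ]
  simp only [roundedHistogram, Fin.cons_zero, Fin.cons_succ]
  exact Nat.sub_add_cancel (sum_natFloor_mass_mul_le ν M n)

theorem tendsto_roundedHistogram_div {ν : FiniteMeanDist} {M : ℕ}
    (hν : ∀ i, M < i → ν.mass i = 0) (i : Fin (M + 1)) :
    Tendsto (fun n : ℕ => (roundedHistogram ν M n i : ℝ) / n) atTop (𝓝 (ν.mass i)) := by
  have hfloor : ∀ j : Fin M, Tendsto (fun n : ℕ => (⌊ν.mass (j + 1) * n⌋₊ : ℝ) / n) atTop
      (𝓝 (ν.mass (j + 1))) := fun j =>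
    (tendsto_nat_floor_mul_div_atTop (ν.mass_nonneg _)).comp
      (tendsto_natCast_atTop_atTop (R := ℝ))
  induction i using Fin.cases with
  | succ j => simpa [roundedHistogram] using hfloor j
  | zero =>
    have h1 : ν.mass 0 = 1 - ∑ j : Fin M, ν.mass (j + 1) := by
      have h2 : HasSum ν.mass (∑ i ∈ Finset.range (M + 1), ν.mass i) :=
        hasSum_sum_of_ne_finset_zero fun i hi =>
          hν i (by rw [Finset.mem_range] at hi; omega)
      have h3 := ν.hasSum_mass.unique h2
      rw [Finset.sum_range_succ'] at h3
      rw [Fin.sum_univ_eq_sum_range (fun j => ν.mass (j + 1))]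
      linarith
    have h2 : Tendsto (fun n : ℕ => 1 - ∑ j : Fin M, (⌊ν.mass (j + 1) * n⌋₊ : ℝ) / n) atTop
        (𝓝 (1 - ∑ j : Fin M, ν.mass (j + 1))) :=
      tendsto_const_nhds.sub (tendsto_finsetSum _ fun j _ => hfloor j)
    rw [Fin.val_zero, h1]
    refine h2.congr' ?_
    filter_upwards [eventually_gt_atTop 0] with n hn
    have hn' : (0 : ℝ) < n := by exact_mod_cast hn
    simp only [roundedHistogram, Fin.cons_zero]
    rw [Nat.cast_sub (sum_natFloor_mass_mul_le ν M n), sub_div, div_self hn'.ne', Nat.cast_sum,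
      Finset.sum_div]

theorem mean_eq_sum_of_mass_eq_zero {ν : FiniteMeanDist} {M : ℕ}
    (hν : ∀ i, M < i → ν.mass i = 0) :
    ν.mean = ∑ i : Fin (M + 1), ((i : ℕ) : ℝ) * ν.mass i := by
  rw [FiniteMeanDist.mean, Fin.sum_univ_eq_sum_range (fun i => (i : ℝ) * ν.mass i)]
  refine tsum_eq_sum fun i hi => ?_
  rw [hν i (by rw [Finset.mem_range] at hi; omega), mul_zero]

theorem continuous_mul_log_const_mul {c : ℝ} (hc : c ≠ 0) :
    Continuous fun x : ℝ => x * Real.log (c * x) := by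
  have h : (fun x : ℝ => x * Real.log (c * x)) = fun x => (c * x) * Real.log (c * x) / c := by
    ext x
    field_simp
  rw [h]
  exact (Real.continuous_mul_log.comp (continuous_const.mul continuous_id)).div_const _

/-- With `M` fixed, the rounding errors, the deficit `c` and the logarithmic terms all vanish after
division by `n`, leaving the rate by continuity. -/
theorem le_liminf_log_erdosRenyi_of_mass_eq_zero {β : ℝ} (hβ : 0 < β) {ν : FiniteMeanDist} {M : ℕ}
    (hν : ∀ i, M < i → ν.mass i = 0) {A : Set FiniteMeanDist} (hA : A ∈ 𝓝 ν) :
    ((-(∑ i : Fin (M + 1), ν.mass i * Real.log (((i : ℕ).factorial : ℝ) * ν.mass i) +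
        meanRate β ν.mean) : ℝ) : EReal) ≤
      liminf (fun n : ℕ+ =>
        ENNReal.log (erdosRenyi β n {G | empiricalDegree G ∈ A}) / ((n : ℝ) : EReal)) atTop := by
  -- The spare half-edges, plus one for parity in halving.
  set c : ℕ := M + M ^ 2 + 1 with hc
  let h : (n : ℕ) → Fin (M + 1) → ℕ := roundedHistogram ν M
  let D : ℕ → ℕ := fun n => ∑ i : Fin (M + 1), (i : ℕ) * h n i
  -- Truncated subtraction gives `m = 0` when there are too few half-edges, as when `ν` is
  -- concentrated at `0`.
  let m : ℕ → ℕ := fun n => (D n - (M + M ^ 2)) / 2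
  have hx : ∀ i, Tendsto (fun n : ℕ => (h n i : ℝ) / n) atTop (𝓝 (ν.mass i)) :=
    tendsto_roundedHistogram_div hν
  have hDlim : Tendsto (fun n : ℕ => (D n : ℝ) / n) atTop (𝓝 ν.mean) := by
    rw [mean_eq_sum_of_mass_eq_zero hν]
    refine (tendsto_finsetSum Finset.univ fun i _ => (hx i).const_mul ((i : ℕ) : ℝ)).congr
      fun n => ?_
    simp only [D]
    rw [Nat.cast_sum, Finset.sum_div]
    refine Finset.sum_congr rfl fun i _ => ?_
    push_cast
    ring
  have hm1 : ∀ n, m n = 0 ∨ 2 * m n + (M + M ^ 2) ≤ D n := by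
    intro n
    simp only [m]
    generalize M + M ^ 2 = K
    omega
  have hm2 : ∀ n, D n ≤ 2 * m n + c := by
    intro n
    simp only [m, hc]
    generalize M + M ^ 2 = K
    omega
  have hm3 : ∀ n, 2 * m n ≤ D n := by
    intro n
    simp only [m]
    generalize M + M ^ 2 = K
    omega
  have hinv : ∀ a : ℝ, Tendsto (fun n : ℕ => a / (n : ℝ)) atTop (𝓝 0) :=
    tendsto_const_div_atTop_nhds_zero_nat
  have hmlim : Tendsto (fun n : ℕ => 2 * (m n : ℝ) / n) atTop (𝓝 ν.mean) := by
    have hlow : Tendsto (fun n : ℕ => (D n : ℝ) / n - c / n) atTop (𝓝 ν.mean) := by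
      simpa using hDlim.sub (hinv c)
    refine tendsto_of_tendsto_of_tendsto_of_le_of_le hlow hDlim (fun n => ?_) fun n => ?_
    · rw [← sub_div]
      have : (D n : ℝ) ≤ 2 * m n + c := by exact_mod_cast hm2 n
      refine div_le_div_of_nonneg_right ?_ (Nat.cast_nonneg n)
      linarith
    · have : 2 * (m n : ℝ) ≤ D n := by exact_mod_cast hm3 n
      exact div_le_div_of_nonneg_right this (Nat.cast_nonneg n)
  have hS : Tendsto (fun n : ℕ => ∑ i : Fin (M + 1), ((h n i : ℝ) / n) *
      Real.log (((i : ℕ).factorial : ℝ) * ((h n i : ℝ) / n))) atTop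
      (𝓝 (∑ i : Fin (M + 1), ν.mass i * Real.log (((i : ℕ).factorial : ℝ) * ν.mass i))) := by
    refine tendsto_finsetSum _ fun i _ => ?_
    exact ((continuous_mul_log_const_mul
      (by positivity : ((i : ℕ).factorial : ℝ) ≠ 0)).tendsto _).comp (hx i)
  have hR : Tendsto (fun n : ℕ => meanRate β (2 * m n / n)) atTop (𝓝 (meanRate β ν.mean)) :=
    ((continuous_meanRate hβ).tendsto _).comp hmlim
  have hq : Tendsto (fun n : ℕ => β / 2 - β / 2 / (1 - β / (n : ℝ))) atTop (𝓝 0) := by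
    have h1 : Tendsto (fun n : ℕ => 1 - β / (n : ℝ)) atTop (𝓝 (1 - 0)) :=
      tendsto_const_nhds.sub (hinv β)
    have h2 := (tendsto_const_nhds (x := β / 2)).sub
      ((tendsto_const_nhds (x := β / 2)).div h1 (by norm_num))
    simpa using h2
  have herr : Tendsto (fun n : ℕ => ((M + 1 : ℝ) * (1 + Real.log (n + 1)) + c * Real.log n) / n)
      atTop (𝓝 0) := by
    have h1 := (((hinv 1).add tendsto_log_natCast_add_one_div_atTop).const_mul (M + 1 : ℝ)).add
      (tendsto_log_natCast_div_atTop.const_mul (c : ℝ))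
    simp only [add_zero, mul_zero] at h1
    refine h1.congr fun n => ?_
    ring
  have hL := ((hS.neg.sub hR).add hq).sub herr
  have hrad : Tendsto (fun n : ℕ => (M : ℝ) * (M + 1) * c / n +
      ∑ i : Fin (M + 1), ((i : ℕ) : ℝ) * |(h n i : ℝ) / n - ν.mass i|) atTop (𝓝 0) := by
    have h1 := (hinv ((M : ℝ) * (M + 1) * c)).add (tendsto_finsetSum Finset.univ fun i _ =>
      (((hx i).sub_const (ν.mass i)).abs.const_mul ((i : ℕ) : ℝ)))
    simpa using h1
  obtain ⟨δ, hδ, hball⟩ := Metric.mem_nhds_iff.1 hA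
  rw [← EReal.ge_of_forall_gt_iff_ge]
  intro z hz
  rw [EReal.coe_lt_coe_iff] at hz
  have hz' : z < -(∑ i : Fin (M + 1), ν.mass i * Real.log (((i : ℕ).factorial : ℝ) * ν.mass i)) -
      meanRate β ν.mean + 0 - 0 := by linarith
  refine le_liminf_of_le (h := ?_)
  filter_upwards [tendsto_PNat_val_atTop_atTop.eventually (hL.eventually (lt_mem_nhds hz')),
    tendsto_PNat_val_atTop_atTop.eventually (hrad.eventually (gt_mem_nhds hδ)),
    tendsto_PNat_val_atTop_atTop.eventually
      ((tendsto_natCast_atTop_atTop (R := ℝ)).eventually (eventually_gt_atTop β))]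
    with n hn1 hn2 hn3
  have hn0 : (0 : ℝ) < (n : ℕ) := by exact_mod_cast n.pos
  refine le_log_div_of_exp_le_real hn0 ?_
  refine le_trans ?_ (exp_le_erdosRenyi_real hβ hn3 (h n) (sum_roundedHistogram ν M n) (hm1 n)
    (hm2 n) hν fun μ hμ => hball (Metric.mem_ball.2 (hμ.trans_lt hn2)))
  rw [Real.exp_le_exp]
  exact mul_le_mul_of_nonneg_left hn1.le hn0.le

namespace FiniteMeanDist

theorem sum_range_mass_succ_le_one (μ : FiniteMeanDist) (M : ℕ) :
    ∑ j ∈ Finset.range M, μ.mass (j + 1) ≤ 1 := by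
  have h2 : ∑ i ∈ Finset.range (M + 1), μ.mass i ≤ 1 :=
    sum_le_hasSum _ (fun i _ => μ.mass_nonneg i) μ.hasSum_mass
  rw [Finset.sum_range_succ'] at h2
  linarith [μ.mass_nonneg 0]

/-- The masses of the truncation of `μ` at `M`. -/
noncomputable def truncMass (μ : FiniteMeanDist) (M : ℕ) : ℕ → ℝ
  | 0 => 1 - ∑ j ∈ Finset.range M, μ.mass (j + 1)
  | i + 1 => if i < M then μ.mass (i + 1) else 0

theorem truncMass_eq_zero (μ : FiniteMeanDist) {M i : ℕ} (hi : M < i) : μ.truncMass M i = 0 := by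
  obtain ⟨j, rfl⟩ : ∃ j, i = j + 1 := ⟨i - 1, by omega⟩
  rw [truncMass, if_neg (by omega)]

theorem truncMass_succ {μ : FiniteMeanDist} {M j : ℕ} (hj : j < M) :
    μ.truncMass M (j + 1) = μ.mass (j + 1) := by
  rw [truncMass, if_pos hj]

/-- The truncation of `μ` at `M`: the mass beyond `M` is moved to `0`. -/
noncomputable def trunc (μ : FiniteMeanDist) (M : ℕ) : FiniteMeanDist :=
  ofMass (μ.truncMass M)
    (fun i => by
      cases i with
      | zero => exact sub_nonneg.2 (μ.sum_range_mass_succ_le_one M)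
      | succ i =>
        rw [truncMass]
        split_ifs
        · exact μ.mass_nonneg _
        · exact le_rfl)
    (by
      have h : ∑ i ∈ Finset.range (M + 1), μ.truncMass M i = 1 := by
        rw [Finset.sum_range_succ', Finset.sum_congr rfl fun j hj =>
          truncMass_succ (Finset.mem_range.1 hj), truncMass]
        ring
      rw [← h]
      exact hasSum_sum_of_ne_finset_zero fun i hi =>
        μ.truncMass_eq_zero (by rw [Finset.mem_range] at hi; omega))
    (summable_of_ne_finset_zero (s := Finset.range (M + 1)) fun i hi => by
      rw [μ.truncMass_eq_zero (by rw [Finset.mem_range] at hi; omega), mul_zero])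

theorem mass_trunc (μ : FiniteMeanDist) (M i : ℕ) : (μ.trunc M).mass i = μ.truncMass M i :=
  mass_ofMass _ _ _ _ _

theorem mass_trunc_eq_zero (μ : FiniteMeanDist) {M i : ℕ} (hi : M < i) :
    (μ.trunc M).mass i = 0 := by
  rw [mass_trunc, truncMass_eq_zero μ hi]

theorem mean_trunc (μ : FiniteMeanDist) (M : ℕ) :
    (μ.trunc M).mean = ∑ j ∈ Finset.range M, ((j + 1 : ℕ) : ℝ) * μ.mass (j + 1) := by
  rw [mean_eq_sum_of_mass_eq_zero fun i hi => μ.mass_trunc_eq_zero hi, Fin.sum_univ_succ,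
    ← Fin.sum_univ_eq_sum_range (fun j => ((j + 1 : ℕ) : ℝ) * μ.mass (j + 1))]
  simp only [Fin.val_zero, Nat.cast_zero, zero_mul, zero_add, Fin.val_succ, mass_trunc]
  exact Finset.sum_congr rfl fun j _ => by rw [truncMass_succ j.2]

theorem tendsto_mean_trunc (μ : FiniteMeanDist) :
    Tendsto (fun M => (μ.trunc M).mean) atTop (𝓝 μ.mean) := by
  simp only [mean_trunc]
  have h := (hasSum_nat_add_iff' 1).2 μ.hasSum_mean
  simp only [Finset.sum_range_one, Nat.cast_zero, zero_mul, sub_zero] at h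
  exact h.tendsto_sum_nat

/-- Mass moved to `0` is invisible to the metric at its destination, so only the lost mean counts.
-/
theorem dist_trunc (μ : FiniteMeanDist) (M : ℕ) :
    dist (μ.trunc M) μ = μ.mean - (μ.trunc M).mean := by
  rw [dist_def, mean, mean, ← μ.summable_mean.tsum_sub (μ.trunc M).summable_mean]
  refine tsum_congr fun i => ?_
  cases i with
  | zero => simp
  | succ i =>
    rw [mass_trunc, truncMass]
    split_ifs
    · simp
    · rw [zero_sub, abs_neg, abs_of_nonneg (μ.mass_nonneg _), mul_zero, sub_zero]

theorem tendsto_trunc (μ : FiniteMeanDist) : Tendsto μ.trunc atTop (𝓝 μ) := by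
  rw [tendsto_iff_dist_tendsto_zero]
  simp only [dist_trunc]
  simpa using (tendsto_const_nhds (x := μ.mean)).sub μ.tendsto_mean_trunc

/-- Truncation leaves the terms from `1` to `M` unchanged, giving partial sums of the series; the
term at `0` converges by continuity of `x log x`. -/
theorem tendsto_entropySum_trunc {μ : FiniteMeanDist}
    (hμ : Summable fun i : ℕ => μ.mass i * Real.log ((i.factorial : ℝ) * μ.mass i)) :
    Tendsto (fun M => ∑ i : Fin (M + 1), (μ.trunc M).mass i *
      Real.log (((i : ℕ).factorial : ℝ) * (μ.trunc M).mass i)) atTop (𝓝 μ.entropySum) := by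
  have h0 : Tendsto (fun M => 1 - ∑ j ∈ Finset.range M, μ.mass (j + 1)) atTop
      (𝓝 (μ.mass 0)) := by
    have h := (hasSum_nat_add_iff' 1).2 μ.hasSum_mass
    have := (tendsto_const_nhds (x := (1 : ℝ))).sub h.tendsto_sum_nat
    simpa using this
  have h1 : Tendsto (fun M => (1 - ∑ j ∈ Finset.range M, μ.mass (j + 1)) *
      Real.log (1 - ∑ j ∈ Finset.range M, μ.mass (j + 1))) atTop
      (𝓝 (μ.mass 0 * Real.log (μ.mass 0))) := (Real.continuous_mul_log.tendsto _).comp h0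
  have h2 := ((hasSum_nat_add_iff' 1).2 hμ.hasSum).tendsto_sum_nat
  have h3 := h1.add h2
  simp only [Finset.sum_range_one, Nat.factorial_zero, Nat.cast_one, one_mul] at h3
  rw [add_sub_cancel] at h3
  refine h3.congr fun M => ?_
  rw [Fin.sum_univ_succ, ← Fin.sum_univ_eq_sum_range
    (fun j => μ.mass (j + 1) * Real.log (((j + 1).factorial : ℝ) * μ.mass (j + 1)))]
  simp only [Fin.val_zero, Fin.val_succ, mass_trunc, Nat.factorial_zero, Nat.cast_one, one_mul]
  congr 1
  exact Finset.sum_congr rfl fun j _ => by rw [truncMass_succ j.2]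

end FiniteMeanDist

/-- Truncations of a point of `interior A` eventually lie in `interior A`, so the finitely supported
bound passes to the limit; points of infinite rate impose nothing. -/
theorem neg_iInf_degreeRate_le_liminf_log_erdosRenyi {β : ℝ} (hβ : 0 < β)
    (A : Set FiniteMeanDist) :
    -(⨅ μ ∈ interior A, degreeRate β μ) ≤ liminf (fun n : ℕ+ =>
      ENNReal.log (erdosRenyi β n {G | empiricalDegree G ∈ A}) / ((n : ℝ) : EReal)) atTop := by
  rw [EReal.neg_le]
  refine le_iInf₂ fun μ hμ => ?_
  rw [EReal.neg_le]
  by_cases htop : degreeRate β μ = ⊤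
  · rw [htop, EReal.neg_top]
    exact bot_le
  have hs := summable_of_degreeRate_ne_top htop
  rw [degreeRate_of_summable β hs, ← EReal.coe_neg]
  have hlim := ((FiniteMeanDist.tendsto_entropySum_trunc hs).add
    (((continuous_meanRate hβ).tendsto _).comp μ.tendsto_mean_trunc)).neg
  refine le_of_tendsto ((continuous_coe_real_ereal.tendsto _).comp hlim) ?_
  filter_upwards [μ.tendsto_trunc.eventually (isOpen_interior.mem_nhds hμ)] with M hM
  exact le_liminf_log_erdosRenyi_of_mass_eq_zero hβ (fun i hi => μ.mass_trunc_eq_zero hi)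
    (mem_interior_iff_mem_nhds.1 hM)

end LowerBound

theorem theorem1p2 (β : ℝ) (hβ : 0 < β) :
    (∀ A : Set FiniteMeanDist,
      limsup (fun n : ℕ+ =>
          ENNReal.log (erdosRenyi β n {G | empiricalDegree G ∈ A}) / ((n : ℝ) : EReal)) atTop
        ≤ -(⨅ μ ∈ A, degreeRate β μ)) ∧
    (∀ A : Set FiniteMeanDist,
      -(⨅ μ ∈ interior A, degreeRate β μ) ≤
        liminf (fun n : ℕ+ =>
          ENNReal.log (erdosRenyi β n {G | empiricalDegree G ∈ A}) / ((n : ℝ) : EReal)) atTop) ∧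
    IsGoodRateFunction (degreeRate β) ∧
    SatisfiesLDP (fun n : ℕ+ => erdosRenyi β n) (fun _ G => empiricalDegree G) atTop
      (fun n : ℕ+ => (n : ℝ)) (degreeRate β) := by
  refine ⟨limsup_log_erdosRenyi_le hβ, neg_iInf_degreeRate_le_liminf_log_erdosRenyi hβ,
    isGoodRateFunction_degreeRate hβ, ?_⟩
  exact
    { nonneg := degreeRate_nonneg hβ
      lowerSemicontinuous := lowerSemicontinuous_degreeRate hβ
      upper_bound := fun F _ => limsup_log_erdosRenyi_le hβ F
      lower_bound := fun O hO => by
        have h := neg_iInf_degreeRate_le_liminf_log_erdosRenyi hβ O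
        rwa [hO.interior_eq] at h }
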